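/- **Theorem (odd-covering theorem).** A *$d$-polytope* $P\subset\mathbb{R}^n$ is a union of finitely many *cells*, each the convex hull of a nonempty finite set of points (its vertices), such that every cell has dimension at most $d$, at least one cell has dimension $d$, every nonempty face of a cell is a cell, and any two cells that meet intersect in a cell spanned by some of their common vertices. ($P$ need not be convex, and $d\le n$ is arbitrary.) A *triangulation* $T$ of $P$ is a finite family of simplices with union $P$, closed under taking faces, in which any two simplices are disjoint or meet in a common face; the vertices of $T$ need not be vertices of $P$. Let $P$ be a $d$-polytope with a triangulation $T$, and let $\tau_1,\dots,\tau_m$ be the $d$-simplices of $T$. For every vertex $v$ of $T$ let $A_v$ be the affine span of the minimal cell of $P$ containing $v$, and let $\gamma_v:[0,1]\to A_v$ be a continuous curve with $\gamma_v(0)=v$. Let $H_t:P\to\mathbb{R}^n$ $(t\in[0,1])$ be the homotopy with $H_t(v)=\gamma_v(t)$ for every vertex $v$ of $T$, extended to $P$ simplex by simplex, linearly in the barycentric coordinates of $T$. Then for every $x\in P$ outside a set of $d$-dimensional measure zero: 1. the number of indices $i$ with $x\in H_1(\tau_i)$ is odd; 2. the number of indices $i$ such that $x\in H_1(\tau_i)$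 and $H_1(\tau_i)$ is positively oriented is exactly one more than the number of indices $i$ such that $x\in H_1(\tau_i)$ and $H_1(\tau_i)$ is negatively oriented. Here $H_1$ maps the vertices of $\tau_i$ into the affine span $A$ of $\tau_i$, and $H_1(\tau_i)$ is called positively (negatively) oriented if the affine map $A\to A$ that agrees with $H_1$ on $\tau_i$ has positive (negative) determinant, i.e. if, for an orientation of $A$ and an ordering of the vertices of $\tau_i$ that makes $\tau_i$ positively oriented, the images of the vertices in that order form a positively (negatively) oriented simplex. -/

import Mathlib

open MeasureTheory Set
open scoped unitInterval

/-- A `d`-polytope in `ℝⁿ` with its cell structure: a finite family of nonempty convex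
hulls of finite sets (the cells, each recorded by its finite set of vertices), of dimension at
most `d`, at least one of dimension `d`. Faces of cells are cells, and the intersection of two
cells, unless empty, is a cell spanned by vertices that the two cells have in common.
Neither convexity, connectedness, purity nor `d = n` is required. -/
structure Polytope (d n : ℕ) where
  /-- the vertex sets of the cells -/
  cells : Finset (Finset (EuclideanSpace ℝ (Fin n)))
  nonempty_of_mem : ∀ V ∈ cells, V.Nonempty
  dim_le : ∀ V ∈ cells,
    Module.finrank ℝ (vectorSpan ℝ (V : Set (EuclideanSpace ℝ (Fin n)))) ≤ d
  exists_dim_eq : ∃ V ∈ cells,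
    Module.finrank ℝ (vectorSpan ℝ (V : Set (EuclideanSpace ℝ (Fin n)))) = d
  face_mem : ∀ V ∈ cells, ∀ F : Set (EuclideanSpace ℝ (Fin n)), F.Nonempty →
    IsExposed ℝ (convexHull ℝ (V : Set (EuclideanSpace ℝ (Fin n)))) F →
    ∃ W ∈ cells, convexHull ℝ (W : Set (EuclideanSpace ℝ (Fin n))) = F
  inter_mem : ∀ V ∈ cells, ∀ W ∈ cells,
    (convexHull ℝ (V : Set (EuclideanSpace ℝ (Fin n))) ∩
      convexHull ℝ (W : Set (EuclideanSpace ℝ (Fin n)))).Nonempty →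
    ∃ S ∈ cells, S ⊆ V ∧ S ⊆ W ∧
      convexHull ℝ (S : Set (EuclideanSpace ℝ (Fin n))) =
        convexHull ℝ (V : Set (EuclideanSpace ℝ (Fin n))) ∩
          convexHull ℝ (W : Set (EuclideanSpace ℝ (Fin n)))

namespace Polytope

variable {d n : ℕ}

/-- The underlying point set: the union of the cells. -/
def space (P : Polytope d n) : Set (EuclideanSpace ℝ (Fin n)) :=
  ⋃ V ∈ P.cells, convexHull ℝ (V : Set (EuclideanSpace ℝ (Fin n)))

/-- The minimal cell containing `x`: the intersection of all cells that contain `x`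
(for `x` in the polytope it is itself a cell, see `exists_minimalCell_eq`). -/
def minimalCell (P : Polytope d n) (x : EuclideanSpace ℝ (Fin n)) :
    Set (EuclideanSpace ℝ (Fin n)) :=
  ⋂ V ∈ {V | V ∈ P.cells ∧ x ∈ convexHull ℝ (V : Set (EuclideanSpace ℝ (Fin n)))},
    convexHull ℝ (V : Set (EuclideanSpace ℝ (Fin n)))

theorem exists_minimalCell_eq (P : Polytope d n) {x : EuclideanSpace ℝ (Fin n)}
    (hx : x ∈ P.space) : ∃ V ∈ P.cells, x ∈ convexHull ℝ (V : Set (EuclideanSpace ℝ (Fin n))) ∧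
      convexHull ℝ (V : Set (EuclideanSpace ℝ (Fin n))) = P.minimalCell x := by
  classical
  have key : ∀ D : Finset (Finset (EuclideanSpace ℝ (Fin n))),
      (∀ W ∈ D, W ∈ P.cells ∧ x ∈ convexHull ℝ (W : Set (EuclideanSpace ℝ (Fin n)))) →
      ∃ V ∈ P.cells, x ∈ convexHull ℝ (V : Set (EuclideanSpace ℝ (Fin n))) ∧
        ∀ W ∈ D, convexHull ℝ (V : Set (EuclideanSpace ℝ (Fin n))) ⊆
          convexHull ℝ (W : Set (EuclideanSpace ℝ (Fin n))) := by
    intro D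
    induction D using Finset.induction_on with
    | empty =>
      intro _
      obtain ⟨V, hV, hxV⟩ := mem_iUnion₂.1 hx
      exact ⟨V, hV, hxV, by simp⟩
    | insert W D _ ih =>
      intro h
      obtain ⟨V, hV, hxV, hsub⟩ := ih fun U hU => h U (Finset.mem_insert_of_mem hU)
      obtain ⟨hW, hxW⟩ := h W (Finset.mem_insert_self _ _)
      obtain ⟨S, hS, -, -, hSeq⟩ := P.inter_mem V hV W hW ⟨x, hxV, hxW⟩
      refine ⟨S, hS, by rw [hSeq]; exact ⟨hxV, hxW⟩, fun U hU => ?_⟩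
      rw [hSeq]
      rcases Finset.mem_insert.1 hU with rfl | hU
      · exact inter_subset_right
      · exact inter_subset_left.trans (hsub U hU)
  obtain ⟨V, hV, hxV, hsub⟩ := key
    (P.cells.filter fun W => x ∈ convexHull ℝ (W : Set (EuclideanSpace ℝ (Fin n))))
    (fun W hW => Finset.mem_filter.1 hW)
  refine ⟨V, hV, hxV, Subset.antisymm ?_ ?_⟩
  · exact subset_iInter₂ fun W hW => hsub W (Finset.mem_filter.2 hW)
  · exact iInter₂_subset V ⟨hV, hxV⟩

/-- A triangulation of the polytope: a finite geometric simplicial complex (simplices closed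
under faces, any two meeting in a common face or not at all) whose union is the polytope.
Simplices are recorded by their vertex sets; new vertices are allowed. -/
structure IsTriangulation (P : Polytope d n)
    (T : Geometry.SimplicialComplex ℝ (EuclideanSpace ℝ (Fin n))) : Prop where
  finite : T.faces.Finite
  space_eq : T.space = P.space

end Polytope

namespace Geometry.SimplicialComplex

variable {E : Type*} [AddCommGroup E] [Module ℝ E]

/-- `w` is the family of barycentric coordinates of the point `x` in the complex `T`. -/
def IsBarycentric (T : SimplicialComplex ℝ E) (x : E) (w : E →₀ ℝ) : Prop :=
  w.support ∈ T.faces ∧ (∀ v, 0 ≤ w v) ∧ (w.sum fun _ a => a) = 1 ∧ (w.sum fun v a => a • v) = x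

theorem exists_isBarycentric {T : SimplicialComplex ℝ E} {s : Finset E} (hs : s ∈ T.faces) {x : E}
    (hx : x ∈ convexHull ℝ (s : Set E)) : ∃ w, T.IsBarycentric x w ∧ w.support ⊆ s := by
  classical
  obtain ⟨w, hw0, hw1, hwx⟩ := Finset.mem_convexHull'.1 hx
  let w' : E →₀ ℝ := Finsupp.onFinset s (fun v => if v ∈ s then w v else 0) (by grind)
  have hval : ∀ v, w' v = if v ∈ s then w v else 0 := fun v => rfl
  have hsupp : w'.support ⊆ s := Finsupp.support_onFinset_subset
  have h1 : (w'.sum fun _ a => a) = 1 := by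
    rw [Finsupp.sum_of_support_subset _ hsupp _ (by simp), ← hw1]
    exact Finset.sum_congr rfl fun v hv => by simp [hval, hv]
  refine ⟨w', ⟨T.down_closed hs hsupp ?_, ?_, h1, ?_⟩, hsupp⟩
  · rw [Finset.nonempty_iff_ne_empty]
    intro h
    simp [Finsupp.sum, h] at h1
  · intro v
    rw [hval]
    split_ifs with hv
    exacts [hw0 v hv, le_rfl]
  · rw [Finsupp.sum_of_support_subset _ hsupp _ (by simp), ← hwx]
    exact Finset.sum_congr rfl fun v hv => by simp [hval, hv]

theorem IsBarycentric.unique {T : SimplicialComplex ℝ E} {x : E} {w w' : E →₀ ℝ}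
    (h : T.IsBarycentric x w) (h' : T.IsBarycentric x w') : w = w' := by
  classical
  have mem : ∀ {u : E →₀ ℝ}, T.IsBarycentric x u → x ∈ convexHull ℝ (u.support : Set E) :=
    fun {u} hu => Finset.mem_convexHull'.2 ⟨u, fun v _ => hu.2.1 v, hu.2.2.1, hu.2.2.2⟩
  have aux : ∀ {u z : E →₀ ℝ}, T.IsBarycentric x u → z.support ⊆ u.support →
      (z.sum fun _ a => a) = 1 → (z.sum fun v a => a • v) = x → u = z := by
    intro u z hu hz h1 hx
    have hind := affineIndependent_iff.1 (T.indep hu.1) Finset.univ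
      (fun v => u v - z v) ?_ ?_
    · ext v
      by_cases hv : v ∈ u.support
      · exact sub_eq_zero.1 (hind ⟨v, hv⟩ (Finset.mem_univ _))
      · rw [Finsupp.notMem_support_iff.1 hv, Finsupp.notMem_support_iff.1 fun h => hv (hz h)]
    · rw [Finset.sum_coe_sort u.support (fun v => u v - z v), Finset.sum_sub_distrib]
      rw [Finsupp.sum_of_support_subset _ hz _ (by simp)] at h1
      rw [h1, sub_eq_zero]
      exact hu.2.2.1
    · rw [Finset.sum_coe_sort u.support (fun v => (u v - z v) • v)]
      simp only [sub_smul]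
      rw [Finset.sum_sub_distrib, sub_eq_zero]
      rw [Finsupp.sum_of_support_subset _ hz _ (by simp)] at hx
      rw [hx]
      exact hu.2.2.2
  have hmem : x ∈ convexHull ℝ ((w.support ∩ w'.support : Finset E) : Set E) := by
    rw [Finset.coe_inter]
    exact T.inter_subset_convexHull h.1 h'.1 ⟨mem h, mem h'⟩
  have hne : (w.support ∩ w'.support).Nonempty := by
    have := convexHull_nonempty_iff.1 ⟨x, hmem⟩
    exact_mod_cast this
  obtain ⟨z, hz, hzs⟩ := exists_isBarycentric
    (T.down_closed h.1 Finset.inter_subset_left hne) hmem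
  rw [aux h (hzs.trans Finset.inter_subset_left) hz.2.2.1 hz.2.2.2,
    aux h' (hzs.trans Finset.inter_subset_right) hz.2.2.1 hz.2.2.2]

open Classical in
/-- The barycentric coordinates of `x` in `T` (they exist and are unique for `x ∈ T.space`;
the value is irrelevant elsewhere). -/
noncomputable def barycentric (T : SimplicialComplex ℝ E) (x : E) : E →₀ ℝ :=
  if h : ∃ w, T.IsBarycentric x w then h.choose else 0

theorem IsBarycentric.barycentric_eq {T : SimplicialComplex ℝ E} {x : E} {w : E →₀ ℝ}
    (h : T.IsBarycentric x w) : T.barycentric x = w := by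
  have hex : ∃ w, T.IsBarycentric x w := ⟨w, h⟩
  rw [barycentric, dif_pos hex]
  exact hex.choose_spec.unique h

/-- The homotopy `H t` that moves each vertex `v` of `T` along `γ v`, extended simplex by simplex
linearly in the barycentric coordinates of `T`. -/
noncomputable def vertexHomotopy (T : SimplicialComplex ℝ E) (γ : E → I → E) (t : I) (x : E) : E :=
  (T.barycentric x).sum fun v a => a • γ v t

/-- The image of the simplex with vertex set `τ` under the map `f`, affine on that simplex, is
positively oriented: `f` maps the vertices of `τ` into the affine span `A` of `τ`, and the linear
part `L` of the resulting affine self-map of `A` has positive determinant. Equivalently, for any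
orientation of `A` and any ordering of the vertices of `τ` that makes `τ` positively oriented, the
images of the vertices in that order form a positively oriented nondegenerate simplex of `A`. -/
def ImagePositive (τ : Finset E) (f : E → E) : Prop :=
  (∀ v ∈ τ, f v ∈ affineSpan ℝ (τ : Set E)) ∧
  ∃ L : vectorSpan ℝ (τ : Set E) →ₗ[ℝ] vectorSpan ℝ (τ : Set E),
    (∀ u : vectorSpan ℝ (τ : Set E), ∀ v ∈ τ, ∀ w ∈ τ, (u : E) = v - w → (L u : E) = f v - f w) ∧
      0 < LinearMap.det L

/-- As `ImagePositive`, with negative determinant: the image simplex is negatively oriented. -/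
def ImageNegative (τ : Finset E) (f : E → E) : Prop :=
  (∀ v ∈ τ, f v ∈ affineSpan ℝ (τ : Set E)) ∧
  ∃ L : vectorSpan ℝ (τ : Set E) →ₗ[ℝ] vectorSpan ℝ (τ : Set E),
    (∀ u : vectorSpan ℝ (τ : Set E), ∀ v ∈ τ, ∀ w ∈ τ, (u : E) = v - w → (L u : E) = f v - f w) ∧
      LinearMap.det L < 0

/-- The `d`-simplices `τ` of `T` (as vertex sets) whose image under `f` contains `x`. -/
def covering (T : SimplicialComplex ℝ E) (d : ℕ) (f : E → E) (x : E) : Set (Finset E) :=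
  {τ | τ ∈ T.faces ∧ τ.card = d + 1 ∧ x ∈ f '' convexHull ℝ (τ : Set E)}

end Geometry.SimplicialComplex

/-!
Move the vertices of the triangulation from their old to their new positions one at a time, and
look at a point `y` that lies on no affine subspace spanned by at most `d` old or new positions;
only a null set is excluded. The signed number of `d`-simplices whose image covers `y` is `1` before
the first move, since simplices of a triangulation overlap only in common faces, and no move
changes it. Indeed, moving `v` to `u` changes the contribution of a simplex `τ ∋ v` by the
contributions of the cones with apex `u` over the facets of `τ` containing `v`. If such a facet `ρ`
belongs to simplices on both sides, their two cones over `ρ` cancel. Otherwise the minimal cell of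
`v` lies in the affine span of `ρ`, hence so does `u`, and the cone is degenerate. Finally, every
image covering `y` is nondegenerate, so it counts as `1` or `-1` and parity follows.
-/

section AffineCombinations

variable {ι E F : Type*} [AddCommGroup E] [Module ℝ E] [AddCommGroup F] [Module ℝ F]

theorem affineMap_sum_smul (α : E →ᵃ[ℝ] F) {s : Finset ι} {c : ι → ℝ} (x : ι → E)
    (hc : ∑ i ∈ s, c i = 1) : α (∑ i ∈ s, c i • x i) = ∑ i ∈ s, c i • α (x i) := by
  have h := Finset.map_affineCombination s x c hc α
  rwa [Finset.affineCombination_eq_linear_combination s x c hc,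
    Finset.affineCombination_eq_linear_combination s _ c hc] at h

theorem sum_smul_mem_affineSubspace {A : AffineSubspace ℝ E} {s : Finset ι} {c : ι → ℝ}
    {x : ι → E} (hc : ∑ i ∈ s, c i = 1) (hx : ∀ i ∈ s, x i ∈ A) : ∑ i ∈ s, c i • x i ∈ A := by
  have hsub : affineSpan ℝ (x '' s) ≤ A := affineSpan_le.2 (image_subset_iff.2 hx)
  rw [← Finset.affineCombination_eq_linear_combination s x c hc]
  exact hsub (affineCombination_mem_affineSpan_image hc (fun i hi hi' => absurd hi hi') x)

theorem mem_affineSpan_image_finset_iff {s : Finset ι} {g : ι → E} {p : E} :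
    p ∈ affineSpan ℝ (g '' s) ↔ ∃ c : ι → ℝ, ∑ i ∈ s, c i = 1 ∧ ∑ i ∈ s, c i • g i = p := by
  classical
  refine ⟨fun hp => ?_, ?_⟩
  · obtain ⟨s', w, hs', hw, rfl⟩ := eq_affineCombination_of_mem_affineSpan_image hp
    have hs' : s' ⊆ s := Finset.coe_subset.1 hs'
    rw [Finset.affineCombination_eq_linear_combination _ _ _ hw]
    refine ⟨fun i => if i ∈ s' then w i else 0, ?_, ?_⟩
    · rwa [Finset.sum_ite_mem, Finset.inter_eq_right.2 hs']
    · simp only [ite_smul, zero_smul]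
      rw [Finset.sum_ite_mem, Finset.inter_eq_right.2 hs']
  · rintro ⟨c, hc, rfl⟩
    exact sum_smul_mem_affineSubspace hc fun i hi =>
      subset_affineSpan ℝ _ (mem_image_of_mem g hi)

theorem exists_affineMap_coord {τ : Finset E} (hτ : AffineIndependent ℝ ((↑) : τ → E)) {w : E}
    (hw : w ∈ τ) : ∃ β : E →ᵃ[ℝ] ℝ, β w = 1 ∧ ∀ v ∈ τ, v ≠ w → β v = 0 := by
  obtain ⟨t, hst, hind, htop⟩ := exists_subset_affineIndependent_affineSpan_eq_top
    (s := (τ : Set E)) hτ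
  let b : AffineBasis t ℝ E := ⟨Subtype.val, hind, by rw [Subtype.range_coe]; exact htop⟩
  refine ⟨b.coord ⟨w, hst hw⟩, b.coord_apply_eq ⟨w, hst hw⟩, fun v hv hvw => ?_⟩
  exact b.coord_apply_ne (i := ⟨w, hst hw⟩) (j := ⟨v, hst hv⟩) fun h => hvw (by
    simpa using congrArg Subtype.val h.symm)

theorem exists_affineMap_eqOn {τ : Finset E} (hτ : AffineIndependent ℝ ((↑) : τ → E))
    (f : E → F) : ∃ α : E →ᵃ[ℝ] F, EqOn α f τ := by
  choose! β hβ_self hβ_ne using fun w (hw : w ∈ τ) => exists_affineMap_coord hτ hw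
  let α : E →ᵃ[ℝ] F :=
    { toFun := fun x => ∑ w ∈ τ, β w x • f w
      linear := ∑ w ∈ τ, (β w).linear.smulRight (f w)
      map_vadd' := fun x u => by
        simp only [AffineMap.map_vadd]
        simp only [vadd_eq_add, add_smul, Finset.sum_add_distrib, LinearMap.sum_apply,
          LinearMap.smulRight_apply] }
  refine ⟨α, fun v hv => ?_⟩
  calc α v = ∑ w ∈ τ, β w v • f w := rfl
    _ = β v v • f v := Finset.sum_eq_single_of_mem v hv fun w hw hwv => by
        rw [hβ_ne w hw v hv hwv.symm, zero_smul]
    _ = f v := by rw [hβ_self v hv, one_smul]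

theorem affineMap_nonneg_of_mem_convexHull {β : E →ᵃ[ℝ] ℝ} {s : Set E} (h : ∀ v ∈ s, 0 ≤ β v)
    {p : E} (hp : p ∈ convexHull ℝ s) : 0 ≤ β p :=
  convexHull_min (t := β ⁻¹' Ici 0) h ((convex_Ici 0).affine_preimage β) hp

theorem affineMap_eq_zero_of_mem_affineSpan {β : E →ᵃ[ℝ] ℝ} {s : Set E} (h : ∀ v ∈ s, β v = 0)
    {p : E} (hp : p ∈ affineSpan ℝ s) : β p = 0 :=
  AffineMap.eqOn_affineSpan (g := AffineMap.const ℝ E 0) h hp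

theorem affineMap_add_sum_smul (α : E →ᵃ[ℝ] ℝ) {ρ : Finset E} {u : E} {a : ℝ}
    {b : E → ℝ} (hab : a + ∑ v ∈ ρ, b v = 1) :
    α (a • u + ∑ v ∈ ρ, b v • v) = a * α u + ∑ v ∈ ρ, b v * α v := by
  have h := affineMap_sum_smul α (s := ρ.insertNone) (c := fun o => o.elim a b)
    (fun o => o.elim u id) (by rwa [Finset.sum_insertNone])
  rwa [Finset.sum_insertNone, Finset.sum_insertNone] at h

theorem add_sum_smul_mem_convexHull_insert {ρ : Finset E} {u : E} {a : ℝ} {b : E → ℝ}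
    (ha : 0 ≤ a) (hb : ∀ v ∈ ρ, 0 ≤ b v) (hab : a + ∑ v ∈ ρ, b v = 1) :
    a • u + ∑ v ∈ ρ, b v • v ∈ convexHull ℝ (insert u (ρ : Set E)) := by
  have h := (convex_convexHull ℝ (insert u (ρ : Set E))).sum_mem (t := ρ.insertNone)
    (w := fun o => o.elim a b) (z := fun o => o.elim u id) ?_ (by rwa [Finset.sum_insertNone]) ?_
  · rwa [Finset.sum_insertNone] at h
  · exact Finset.forall_mem_insertNone.2 ⟨ha, hb⟩
  · exact Finset.forall_mem_insertNone.2 ⟨subset_convexHull ℝ _ (mem_insert _ _),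
      fun v hv => subset_convexHull ℝ _ (mem_insert_of_mem _ hv)⟩

end AffineCombinations

section LineThroughOrthant

variable {κ : Type*} [Fintype κ]

open Classical in
theorem sum_increasing_facets_eq_ite {lam mu : κ → ℝ} (hmu : ∃ k, 0 < mu k)
    (hgen : ∀ s k l, lam k + s * mu k = 0 → lam l + s * mu l = 0 → k = l) :
    (∑ k with 0 < mu k,
      if ∃ s, (∀ l, 0 ≤ lam l + s * mu l) ∧ lam k + s * mu k = 0 then (1 : ℤ) else 0) =
      if ∃ s, ∀ l, 0 ≤ lam l + s * mu l then 1 else 0 := by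
  split_ifs with hfeas
  · obtain ⟨s₀, hs₀⟩ := hfeas
    obtain ⟨k₀, hk₀, hmax⟩ := Finset.exists_max_image {k | 0 < mu k} (fun k => -lam k / mu k)
      (hmu.imp fun k hk => by simpa using hk)
    simp only [Finset.mem_filter, Finset.mem_univ, true_and] at hk₀ hmax
    set s₁ := -lam k₀ / mu k₀ with hs₁
    have hzero : lam k₀ + s₁ * mu k₀ = 0 := by rw [hs₁]; field_simp; ring
    have hle : s₁ ≤ s₀ := by rw [hs₁, div_le_iff₀ hk₀]; linarith [hs₀ k₀]
    have hmem : ∀ l, 0 ≤ lam l + s₁ * mu l := fun l => by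
      rcases lt_or_ge 0 (mu l) with hl | hl
      · have := (div_le_iff₀ hl).1 (hmax l hl)
        linarith
      · nlinarith [hs₀ l]
    rw [Finset.sum_eq_single_of_mem k₀ (by simpa using hk₀), if_pos ⟨s₁, hmem, hzero⟩]
    intro k hk hne
    refine if_neg fun ⟨s, hs, hks⟩ => hne (hgen s₁ k k₀ ?_ hzero)
    have hk' : 0 < mu k := by simpa using hk
    have hle₁ : s ≤ s₁ := by nlinarith [hmem k]
    have hle₂ : s₁ ≤ s := by nlinarith [hs k₀]
    rwa [le_antisymm hle₂ hle₁]
  · exact Finset.sum_eq_zero fun k _ => if_neg fun ⟨s, hs, _⟩ => hfeas ⟨s, hs⟩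

open Classical in
theorem sum_sign_facets_eq_zero {lam mu : κ → ℝ} (hpos : ∃ k, 0 < mu k) (hneg : ∃ k, mu k < 0)
    (hgen : ∀ s k l, lam k + s * mu k = 0 → lam l + s * mu l = 0 → k = l) :
    ∑ k, (SignType.sign (mu k) : ℤ) *
      (if ∃ s, (∀ l, 0 ≤ lam l + s * mu l) ∧ lam k + s * mu k = 0 then 1 else 0) = 0 := by
  have hup := sum_increasing_facets_eq_ite hpos hgen
  have hdown := sum_increasing_facets_eq_ite (lam := lam) (mu := -mu) (by simpa using hneg)
    (fun s k l hk hl => hgen (-s) k l (by simpa using hk) (by simpa using hl))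
  have hreverse : ∀ p : ℝ → Prop, (∃ s, p (-s)) ↔ ∃ s, p s := fun p =>
    (Equiv.neg ℝ).surjective.exists.symm
  have hdown' : (∑ k with mu k < 0,
      if ∃ s, (∀ l, 0 ≤ lam l + s * mu l) ∧ lam k + s * mu k = 0 then (1 : ℤ) else 0) =
      if ∃ s, ∀ l, 0 ≤ lam l + s * mu l then 1 else 0 := by
    simpa only [Pi.neg_apply, mul_neg, ← neg_mul, Left.neg_pos_iff, hreverse fun s =>
      ∀ l, 0 ≤ lam l + s * mu l, fun k => hreverse fun s =>
      (∀ l, 0 ≤ lam l + s * mu l) ∧ lam k + s * mu k = 0] using hdown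
  have hsplit : ∀ k, (SignType.sign (mu k) : ℤ) =
      (if 0 < mu k then 1 else 0) - if mu k < 0 then 1 else 0 := fun k => by
    rcases lt_trichotomy (mu k) 0 with h | h | h <;> simp [h, h.not_gt]
  simp only [hsplit, sub_mul, ite_mul, one_mul, zero_mul, Finset.sum_sub_distrib,
    ← Finset.sum_filter, hup, hdown', sub_self]

open Classical in
theorem ite_nonneg_eq_sum_sign_ray {a c : κ → ℝ} (hc : ∃ k, 0 < c k)
    (hgen₀ : ∀ k, a k ≠ 0)
    (hgen : ∀ s k l, a k = s * c k → a l = s * c l → k = l) :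
    (if ∀ k, 0 ≤ a k then (1 : ℤ) else 0) = ∑ k, (SignType.sign (c k) : ℤ) *
      (if ∃ s, 0 ≤ s ∧ (∀ l, 0 ≤ a l - s * c l) ∧ a k = s * c k then 1 else 0) := by
  have h := sum_sign_facets_eq_zero (κ := Option κ) (lam := fun o => o.elim 0 a)
    (mu := fun o => o.elim 1 (-c)) ⟨none, one_pos⟩ ?_ ?_
  · simp only [Fintype.sum_option, Option.forall, Option.elim, sign_one, SignType.coe_one, one_mul,
      zero_add, mul_one, Pi.neg_apply, Left.sign_neg, SignType.coe_neg, neg_mul,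
      Finset.sum_neg_distrib] at h
    have hzero : (∃ s, (0 ≤ s ∧ ∀ l, 0 ≤ a l + s * -c l) ∧ s = 0) ↔ ∀ k, 0 ≤ a k :=
      ⟨by rintro ⟨_, ⟨-, h⟩, rfl⟩; simpa using h, fun h => ⟨0, ⟨le_rfl, by simpa using h⟩, rfl⟩⟩
    rw [hzero, add_neg_eq_zero] at h
    simp only [mul_neg, ← sub_eq_add_neg, sub_eq_zero, and_assoc] at h
    convert h
  · exact hc.elim fun k hk => ⟨some k, by simpa using hk⟩
  · rintro s (_ | k) (_ | l) hk hl
    · rfl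
    · simp only [Option.elim] at hk hl
      exact absurd (by simpa [show s = 0 by simpa using hk] using hl) (hgen₀ l)
    · simp only [Option.elim] at hk hl
      exact absurd (by simpa [show s = 0 by simpa using hl] using hk) (hgen₀ k)
    · simp only [Option.elim, Pi.neg_apply] at hk hl
      exact congrArg some (hgen s k l (by linarith) (by linarith))

end LineThroughOrthant

section ImageSign

open Geometry.SimplicialComplex

variable {E : Type*} [AddCommGroup E] [Module ℝ E] {τ τ' : Finset E} {g g' : E → E}

open Classical in
/-- The orientation of the image of the simplex `τ` under `f`, as a sign: `1` if it is positively
oriented, `-1` if it is negatively oriented, and `0` if it is degenerate or leaves the affine span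
of `τ`. -/
noncomputable def imageSign (τ : Finset E) (f : E → E) : ℤ :=
  (if ImagePositive τ f then 1 else 0) - if ImageNegative τ f then 1 else 0

theorem imageSign_congr (h : EqOn g g' τ) : imageSign τ g = imageSign τ g' := by
  have hmaps : (∀ v ∈ τ, g v ∈ affineSpan ℝ (τ : Set E)) ↔
      ∀ v ∈ τ, g' v ∈ affineSpan ℝ (τ : Set E) := forall₂_congr fun v hv => by rw [h hv]
  have hlinear : ∀ L : vectorSpan ℝ (τ : Set E) →ₗ[ℝ] vectorSpan ℝ (τ : Set E),
      (∀ u : vectorSpan ℝ (τ : Set E), ∀ v ∈ τ, ∀ w ∈ τ, (u : E) = v - w → (L u : E) = g v - g w) ↔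
      ∀ u : vectorSpan ℝ (τ : Set E), ∀ v ∈ τ, ∀ w ∈ τ, (u : E) = v - w → (L u : E) = g' v - g' w :=
    fun L => forall_congr' fun u => forall₂_congr fun v hv => forall₂_congr fun w hw => by
      rw [h hv, h hw]
  have hpos : ImagePositive τ g = ImagePositive τ g' := by simp only [ImagePositive, hmaps, hlinear]
  have hneg : ImageNegative τ g = ImageNegative τ g' := by simp only [ImageNegative, hmaps, hlinear]
  rw [imageSign, imageSign, hpos, hneg]

theorem exists_restrict_vectorSpan {U : Submodule ℝ E} (hU : vectorSpan ℝ (τ : Set E) = U)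
    {α : E →ᵃ[ℝ] E} (hα : EqOn α g τ) (hg : MapsTo g τ (affineSpan ℝ (τ : Set E))) :
    ∃ L : U →ₗ[ℝ] U, ∀ u, (L u : E) = α.linear u := by
  have hmap : U.map α.linear ≤ U := by
    rw [← hU, AffineMap.map_vectorSpan, hα.image_eq, ← direction_affineSpan ℝ (τ : Set E)]
    exact vectorSpan_mono ℝ hg.image_subset
  exact ⟨α.linear.restrict (Submodule.map_le_iff_le_comap.1 hmap), fun u => rfl⟩

theorem imageSign_eq_sign_det {U : Submodule ℝ E} (hU : vectorSpan ℝ (τ : Set E) = U)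
    {α : E →ᵃ[ℝ] E} (hα : EqOn α g τ) (hg : MapsTo g τ (affineSpan ℝ (τ : Set E)))
    {L : U →ₗ[ℝ] U} (hL : ∀ u, (L u : E) = α.linear u) :
    imageSign τ g = SignType.sign (LinearMap.det L) := by
  subst hU
  let IsLinearPart (L' : vectorSpan ℝ (τ : Set E) →ₗ[ℝ] vectorSpan ℝ (τ : Set E)) : Prop :=
    ∀ u : vectorSpan ℝ (τ : Set E), ∀ v ∈ τ, ∀ w ∈ τ, (u : E) = v - w → (L' u : E) = g v - g w
  have hpart : IsLinearPart L := fun u v hv w hw hu => by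
    rw [hL, hu, ← vsub_eq_sub, AffineMap.linearMap_vsub, hα hv, hα hw, vsub_eq_sub]
  have hunique : ∀ L', IsLinearPart L' → L' = L := fun L' hL' => by
    refine LinearMap.ext_on (Submodule.span_setOfPred_mem_eq_top (R := ℝ)
      (s := (τ : Set E) -ᵥ τ)) ?_
    rintro u ⟨v, hv, w, hw, hu⟩
    exact Subtype.ext ((hL' u v hv w hw hu.symm).trans (hpart u v hv w hw hu.symm).symm)
  have hpos : ImagePositive τ g ↔ 0 < LinearMap.det L :=
    ⟨fun ⟨_, L', hL', hdet⟩ => hunique L' hL' ▸ hdet, fun hdet => ⟨hg, L, hpart, hdet⟩⟩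
  have hneg : ImageNegative τ g ↔ LinearMap.det L < 0 :=
    ⟨fun ⟨_, L', hL', hdet⟩ => hunique L' hL' ▸ hdet, fun hdet => ⟨hg, L, hpart, hdet⟩⟩
  rw [imageSign, hpos, hneg]
  rcases lt_trichotomy (LinearMap.det L) 0 with h | h | h <;> simp [h, h.not_gt]

theorem mapsTo_of_imageSign_ne_zero (h : imageSign τ g ≠ 0) :
    MapsTo g τ (affineSpan ℝ (τ : Set E)) := by
  by_contra hg
  refine h ?_
  rw [imageSign, if_neg fun hpos => hg hpos.1, if_neg fun hneg => hg hneg.1, sub_zero]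

theorem imageSign_id : imageSign τ id = 1 := by
  rw [imageSign_eq_sign_det (g := id) rfl (α := AffineMap.id ℝ E) (fun _ _ => rfl)
    (subset_affineSpan ℝ (τ : Set E)) (L := LinearMap.id) fun _ => rfl, LinearMap.det_id, sign_one,
    SignType.coe_one]

theorem imageSign_ne_zero_iff {α : E →ᵃ[ℝ] E} (hα : EqOn α g τ)
    (hg : MapsTo g τ (affineSpan ℝ (τ : Set E))) :
    imageSign τ g ≠ 0 ↔ vectorSpan ℝ (g '' τ) = vectorSpan ℝ (τ : Set E) := by
  obtain ⟨L, hL⟩ := exists_restrict_vectorSpan rfl hα hg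
  have := finiteDimensional_vectorSpan_of_finite ℝ τ.finite_toSet
  have hrange : vectorSpan ℝ (g '' τ) =
      (LinearMap.range L).map (vectorSpan ℝ (τ : Set E)).subtype := by
    rw [← hα.image_eq, ← AffineMap.map_vectorSpan, ← LinearMap.range_comp,
      show (vectorSpan ℝ (τ : Set E)).subtype ∘ₗ L = α.linear ∘ₗ Submodule.subtype _ from
        LinearMap.ext hL, LinearMap.range_comp, Submodule.range_subtype]
  have hdet : LinearMap.det L ≠ 0 ↔ LinearMap.range L = ⊤ := by
    rw [← isUnit_iff_ne_zero, ← LinearMap.isUnit_iff_isUnit_det, LinearMap.isUnit_iff_range_eq_top]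
  have hsign : ∀ r : ℝ, (SignType.sign r : ℤ) ≠ 0 ↔ r ≠ 0 := fun r => by
    rcases lt_trichotomy r 0 with h | rfl | h <;> simp [*, ne_of_gt, ne_of_lt]
  rw [imageSign_eq_sign_det rfl hα hg hL, hrange, hsign, hdet,
    ← (Submodule.map_injective_of_injective (Submodule.subtype_injective _)).eq_iff,
    Submodule.map_subtype_top]

/-- Precomposing with `x ↦ x + φ x • e` composes the linear part with a transvection. -/
theorem imageSign_comp_transvection (hspan : affineSpan ℝ (τ' : Set E) = affineSpan ℝ (τ : Set E))
    {α : E →ᵃ[ℝ] E} (hα : EqOn α g τ) (hg : MapsTo g τ (affineSpan ℝ (τ : Set E)))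
    (φ : E →ᵃ[ℝ] ℝ) {e : E} (he : e ∈ vectorSpan ℝ (τ : Set E))
    (hg' : ∀ v ∈ τ', g' v = α (v + φ v • e)) :
    imageSign τ' g' = (SignType.sign (1 + φ.linear e) : ℤ) * imageSign τ g := by
  set U := vectorSpan ℝ (τ : Set E) with hU
  have hU' : vectorSpan ℝ (τ' : Set E) = U := by
    rw [hU, ← direction_affineSpan, hspan, direction_affineSpan]
  have : FiniteDimensional ℝ U := finiteDimensional_vectorSpan_of_finite ℝ τ.finite_toSet
  obtain ⟨L, hL⟩ := exists_restrict_vectorSpan hU.symm hα hg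
  let shear : E →ᵃ[ℝ] E := AffineMap.id ℝ E + (LinearMap.toSpanSingleton ℝ E e).toAffineMap.comp φ
  let M := LinearMap.transvection (φ.linear.domRestrict U) ⟨e, he⟩
  have hmaps : MapsTo g' τ' (affineSpan ℝ (τ' : Set E)) := fun v hv => by
    have hmem : v + φ v • e ∈ affineSpan ℝ (τ : Set E) := by
      rw [add_comm, ← vadd_eq_add]
      exact AffineSubspace.vadd_mem_of_mem_direction
        (by rw [direction_affineSpan]; exact Submodule.smul_mem _ _ he)
        (hspan ▸ subset_affineSpan ℝ _ hv)
    have himage : (affineSpan ℝ (τ : Set E)).map α ≤ affineSpan ℝ (τ : Set E) := by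
      rw [AffineSubspace.map_span, hα.image_eq]
      exact affineSpan_le.2 hg.image_subset
    rw [hg' v hv, hspan]
    exact himage ⟨_, hmem, rfl⟩
  have hlin : ∀ u, ((L ∘ₗ M) u : E) = (α.comp shear).linear u := fun u => hL (M u)
  rw [imageSign_eq_sign_det hU' (α := α.comp shear) (fun v hv => (hg' v hv).symm) hmaps hlin,
    imageSign_eq_sign_det hU.symm hα hg hL, LinearMap.det_comp, LinearMap.transvection.det,
    sign_mul, SignType.coe_mul, mul_comm]
  rfl

theorem imageSign_update [DecidableEq E] (hτ : AffineIndependent ℝ ((↑) : τ → E))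
    (hg : MapsTo g τ (affineSpan ℝ (τ : Set E))) {w : E} (hw : w ∈ τ) {c : E → ℝ}
    (hc : ∑ v ∈ τ, c v = 1) :
    imageSign τ (Function.update g w (∑ v ∈ τ, c v • g v)) =
      (SignType.sign (c w) : ℤ) * imageSign τ g := by
  obtain ⟨α, hα⟩ := exists_affineMap_eqOn hτ g
  obtain ⟨β, hβw, hβ⟩ := exists_affineMap_coord hτ hw
  set x := ∑ v ∈ τ, c v • v with hx
  have hxτ : x ∈ affineSpan ℝ (τ : Set E) :=
    sum_smul_mem_affineSubspace hc fun v hv => subset_affineSpan ℝ _ hv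
  have hαx : α x = ∑ v ∈ τ, c v • g v := by
    rw [hx, affineMap_sum_smul α _ hc]
    exact Finset.sum_congr rfl fun v hv => by rw [hα hv]
  have hβx : β x = c w := by
    rw [hx, affineMap_sum_smul β _ hc, Finset.sum_eq_single_of_mem w hw fun v hv hvw => by
      rw [hβ v hv hvw, smul_zero], hβw, smul_eq_mul, mul_one]
  have he : x - w ∈ vectorSpan ℝ (τ : Set E) := by
    rw [← direction_affineSpan]
    exact AffineSubspace.vsub_mem_direction hxτ (subset_affineSpan ℝ _ hw)
  rw [imageSign_comp_transvection rfl hα hg β he fun v hv => ?_, ← vsub_eq_sub x,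
    AffineMap.linearMap_vsub, hβx, hβw, vsub_eq_sub, add_sub_cancel]
  by_cases hvw : v = w
  · rw [hvw, Function.update_self, hβw, one_smul, add_sub_cancel, hαx]
  · rw [Function.update_of_ne hvw, hβ v hv hvw, zero_smul, add_zero, hα hv]

theorem imageSign_comp_swap [DecidableEq E] (hτ : AffineIndependent ℝ ((↑) : τ → E))
    (hg : MapsTo g τ (affineSpan ℝ (τ : Set E))) {v w : E} (hv : v ∈ τ) (hw : w ∈ τ) (hvw : v ≠ w) :
    imageSign τ (g ∘ Equiv.swap v w) = -imageSign τ g := by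
  obtain ⟨α, hα⟩ := exists_affineMap_eqOn hτ g
  obtain ⟨β, hβv, hβ⟩ := exists_affineMap_coord hτ hv
  obtain ⟨β', hβw', hβ'⟩ := exists_affineMap_coord hτ hw
  have hlin : (β - β').linear (w - v) = -2 := by
    rw [← vsub_eq_sub w, AffineMap.linearMap_vsub, AffineMap.coe_sub, Pi.sub_apply, Pi.sub_apply,
      hβ w hw hvw.symm, hβw', hβv, hβ' v hv hvw]
    norm_num
  rw [imageSign_comp_transvection rfl hα hg (β - β') (vsub_mem_vectorSpan ℝ hw hv) fun u hu => ?_,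
    vsub_eq_sub, hlin]
  · norm_num
  rcases eq_or_ne u v with rfl | huv
  · simp [hβv, hβ' u hu hvw, hα hw]
  rcases eq_or_ne u w with rfl | huw
  · simp [hβw', hβ u hu huv, hα hv]
  · simp [Equiv.swap_apply_of_ne_of_ne huv huw, hβ u hu huv, hβ' u hu huw, hα hu]

theorem imageSign_exchange [DecidableEq E] {ρ : Finset E} {w w' u : E}
    (hw : w ∉ ρ) (hw' : w' ∉ ρ) (hind : AffineIndependent ℝ ((↑) : ↥(insert w ρ) → E))
    (hspan : affineSpan ℝ ((insert w' ρ : Finset E) : Set E) =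
      affineSpan ℝ ((insert w ρ : Finset E) : Set E))
    (hg : MapsTo (Function.update g w u) (insert w ρ : Finset E)
      (affineSpan ℝ ((insert w ρ : Finset E) : Set E)))
    {β : E →ᵃ[ℝ] ℝ} (hβρ : ∀ v ∈ ρ, β v = 0) (hβ : β w * β w' < 0) :
    imageSign (insert w' ρ) (Function.update g w' u) =
      -imageSign (insert w ρ) (Function.update g w u) := by
  have hβw' : β w' ≠ 0 := right_ne_zero_of_mul hβ.ne
  obtain ⟨α, hα⟩ := exists_affineMap_eqOn hind (Function.update g w u)
  have he : w - w' ∈ vectorSpan ℝ ((insert w ρ : Finset E) : Set E) := by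
    rw [← direction_affineSpan]
    exact AffineSubspace.vsub_mem_direction (subset_affineSpan ℝ _ (Finset.mem_insert_self w ρ))
      (hspan ▸ subset_affineSpan ℝ _ (Finset.mem_insert_self w' ρ))
  have hlin : 1 + ((β w')⁻¹ • β).linear (w - w') < 0 := by
    rw [← vsub_eq_sub w, AffineMap.linearMap_vsub]
    have : 1 + ((β w')⁻¹ • β w - (β w')⁻¹ • β w') = (β w * β w') / (β w' * β w') := by
      simp only [smul_eq_mul]
      field_simp
      ring
    exact this.trans_lt (div_neg_of_neg_of_pos hβ (mul_self_pos.2 hβw'))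
  rw [imageSign_comp_transvection hspan hα hg ((β w')⁻¹ • β) he fun v hv => ?_, sign_neg hlin]
  · simp
  rcases Finset.mem_insert.1 hv with rfl | hvρ
  · have hφ : ((β v)⁻¹ • β) v = 1 := inv_mul_cancel₀ hβw'
    rw [Function.update_self, hφ, one_smul, add_sub_cancel, hα (Finset.mem_insert_self w ρ),
      Function.update_self]
  · have hφ : ((β w')⁻¹ • β) v = 0 := by simp [hβρ v hvρ]
    rw [hφ, zero_smul, add_zero, hα (Finset.mem_insert_of_mem hvρ),
      Function.update_of_ne (ne_of_mem_of_not_mem hvρ hw'),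
      Function.update_of_ne (ne_of_mem_of_not_mem hvρ hw)]

end ImageSign

/-- The point `y` is in general position with respect to `Q` in dimension `d`: it lies on no affine
subspace spanned by at most `d` points of `Q`. -/
def InGeneralPosition {E : Type*} [AddCommGroup E] [Module ℝ E] (d : ℕ) (Q : Set E) (y : E) :
    Prop :=
  ∀ s : Finset E, (s : Set E) ⊆ Q → s.card ≤ d → y ∉ affineSpan ℝ (s : Set E)

section BarycentricCoordinates

variable {κ E : Type*} [Fintype κ] [AddCommGroup E] [Module ℝ E] {d : ℕ} {Q : Set E} {p : κ → E}
  {y : E} {a b c : κ → ℝ}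

theorem mem_convexHull_range_iff :
    y ∈ convexHull ℝ (range p) ↔
      ∃ b : κ → ℝ, (∀ k, 0 ≤ b k) ∧ ∑ k, b k = 1 ∧ ∑ k, b k • p k = y := by
  constructor
  · intro hy
    rw [convexHull_range_eq_exists_affineCombination] at hy
    obtain ⟨s, w, hw₀, hw₁, rfl⟩ := hy
    classical
    refine ⟨fun k => if k ∈ s then w k else 0, fun k => ?_, by simpa using hw₁, ?_⟩
    · dsimp only
      split_ifs with hk
      exacts [hw₀ k hk, le_rfl]
    · rw [Finset.affineCombination_eq_linear_combination _ _ _ hw₁]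
      simp [ite_smul]
  · rintro ⟨b, hb₀, hb₁, rfl⟩
    exact (convex_convexHull ℝ _).sum_mem (fun k _ => hb₀ k) hb₁
      fun k _ => subset_convexHull ℝ _ (mem_range_self k)

theorem coeff_eq_of_sum_smul_eq (hp : AffineIndependent ℝ p) (ha : ∑ k, a k = 1)
    (hb : ∑ k, b k = 1) (hab : ∑ k, a k • p k = ∑ k, b k • p k) : a = b := by
  refine (affineIndependent_iff_eq_of_fintype_affineCombination_eq ℝ p).1 hp a b ha hb ?_
  rw [Finset.affineCombination_eq_linear_combination _ _ _ ha,
    Finset.affineCombination_eq_linear_combination _ _ _ hb, hab]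

theorem mem_convexHull_range_iff_forall_nonneg (hp : AffineIndependent ℝ p) (ha : ∑ k, a k = 1) :
    ∑ k, a k • p k ∈ convexHull ℝ (range p) ↔ ∀ k, 0 ≤ a k := by
  refine ⟨fun hy => ?_, fun ha₀ => mem_convexHull_range_iff.2 ⟨a, ha₀, ha, rfl⟩⟩
  obtain ⟨b, hb₀, hb₁, hb⟩ := mem_convexHull_range_iff.1 hy
  rwa [coeff_eq_of_sum_smul_eq hp ha hb₁ hb.symm]

variable [DecidableEq κ]

theorem sum_update_smul_update {w : κ} {s : ℝ} (haw : a w = s * c w) :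
    ∑ k, Function.update (fun l => a l - s * c l) w s k •
      Function.update p w (∑ l, c l • p l) k = ∑ k, a k • p k := by
  have hterm : ∀ k, Function.update (fun l => a l - s * c l) w s k •
      Function.update p w (∑ l, c l • p l) k =
      a k • p k - s • c k • p k + if k = w then s • ∑ l, c l • p l else 0 := fun k => by
    rcases eq_or_ne k w with rfl | hk
    · simp [haw, mul_smul]
    · simp [hk, sub_smul, mul_smul]
  simp [hterm, Finset.sum_add_distrib, Finset.sum_sub_distrib, Finset.smul_sum]

theorem sum_update_coeff {w : κ} {s : ℝ} (hc : ∑ k, c k = 1) (haw : a w = s * c w) :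
    ∑ k, Function.update (fun l => a l - s * c l) w s k = ∑ k, a k := by
  simpa [hc] using sum_update_smul_update (p := fun _ => (1 : ℝ)) haw

theorem mem_convexHull_range_update_iff (hp : AffineIndependent ℝ p) (ha : ∑ k, a k = 1)
    (hc : ∑ k, c k = 1) (w : κ) :
    ∑ k, a k • p k ∈ convexHull ℝ (range (Function.update p w (∑ k, c k • p k))) ↔
      ∃ s, 0 ≤ s ∧ (∀ l, 0 ≤ a l - s * c l) ∧ a w = s * c w := by
  constructor
  · intro hy
    obtain ⟨b, hb₀, hb₁, hb⟩ := mem_convexHull_range_iff.1 hy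
    let a' : κ → ℝ := fun l => Function.update b w 0 l + b w * c l
    have ha'w : a' w = b w * c w := by simp [a']
    have hb' : Function.update (fun l => a' l - b w * c l) w (b w) = b := by simp [a']
    have ha' : a = a' := by
      refine coeff_eq_of_sum_smul_eq hp ha ?_ ?_
      · rw [← sum_update_coeff hc ha'w, hb', hb₁]
      · rw [← sum_update_smul_update ha'w, hb', hb]
    refine ⟨b w, hb₀ w, fun l => ?_, ha' ▸ ha'w⟩
    rw [ha', add_sub_cancel_right]
    rcases eq_or_ne l w with rfl | hl <;> simp [*]
  · rintro ⟨s, hs, hl, haw⟩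
    refine mem_convexHull_range_iff.2 ⟨_, fun k => ?_, (sum_update_coeff hc haw).trans ha,
      sum_update_smul_update haw⟩
    rcases eq_or_ne k w with rfl | hk <;> simp [*]

omit [DecidableEq κ] in
theorem InGeneralPosition.coeff_ne_zero (hy : InGeneralPosition d Q (∑ k, a k • p k))
    (hd : Fintype.card κ ≤ d + 1) (hpQ : range p ⊆ Q) (ha : ∑ k, a k = 1) (w : κ) : a w ≠ 0 := by
  classical
  intro haw
  refine hy ((Finset.univ.erase w).image p) ?_ ?_ ?_
  · intro q hq
    obtain ⟨k, -, rfl⟩ := Finset.mem_image.1 (Finset.mem_coe.1 hq)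
    exact hpQ (mem_range_self k)
  · refine Finset.card_image_le.trans ?_
    rw [Finset.card_erase_of_mem (Finset.mem_univ w), Finset.card_univ]
    omega
  · rw [← Finset.sum_erase (s := Finset.univ) (a := w) (f := fun k => a k • p k) (by simp [haw])]
    refine sum_smul_mem_affineSubspace ?_ fun k hk =>
      subset_affineSpan ℝ _ (Finset.mem_coe.2 (Finset.mem_image_of_mem p hk))
    rwa [Finset.sum_erase _ haw]

open Classical in
theorem ite_mem_convexHull_range_eq_sum (hp : AffineIndependent ℝ p) (ha : ∑ k, a k = 1)
    (hc : ∑ k, c k = 1) (hd : Fintype.card κ ≤ d + 1) (hpQ : range p ⊆ Q)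
    (hcQ : ∑ k, c k • p k ∈ Q) (hy : InGeneralPosition d Q (∑ k, a k • p k)) :
    (if ∑ k, a k • p k ∈ convexHull ℝ (range p) then (1 : ℤ) else 0) =
      ∑ w, (SignType.sign (c w) : ℤ) *
        if ∑ k, a k • p k ∈ convexHull ℝ (range (Function.update p w (∑ k, c k • p k)))
          then 1 else 0 := by
  simp only [mem_convexHull_range_iff_forall_nonneg hp ha, mem_convexHull_range_update_iff hp ha hc]
  convert ite_nonneg_eq_sum_sign_ray ?_ (hy.coeff_ne_zero hd hpQ ha) fun s k l hk hl => ?_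
  · obtain ⟨k, -, hk⟩ := Finset.exists_lt_of_sum_lt (s := Finset.univ) (f := fun _ => (0 : ℝ))
      (g := c) (by simp [hc])
    exact ⟨k, hk⟩
  · by_contra hkl
    rw [← sum_update_smul_update hk] at hy
    refine hy.coeff_ne_zero hd ?_ ((sum_update_coeff hc hk).trans ha) l ?_
    · rintro - ⟨j, rfl⟩
      rcases eq_or_ne j k with rfl | hj
      · simpa using hcQ
      · simpa [hj] using hpQ (mem_range_self j)
    · simp [Ne.symm hkl, hl]

end BarycentricCoordinates

section CoverSign

variable {E : Type*} [AddCommGroup E] [Module ℝ E] {d : ℕ} {Q : Set E} {y u : E} {τ : Finset E}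
  {g g' : E → E}

theorem finrank_vectorSpan_of_card (hτ : AffineIndependent ℝ ((↑) : τ → E))
    (hcard : τ.card = d + 1) : Module.finrank ℝ (vectorSpan ℝ (τ : Set E)) = d := by
  rw [show (τ : Set E) = range ((↑) : τ → E) from Subtype.range_coe.symm]
  exact hτ.finrank_vectorSpan (by rw [Fintype.card_coe, hcard])

theorem InGeneralPosition.le_finrank_vectorSpan (hy : InGeneralPosition d Q y) {s : Set E}
    (hs : s.Finite) (hsQ : s ⊆ Q) (hys : y ∈ affineSpan ℝ s) :
    d ≤ Module.finrank ℝ (vectorSpan ℝ s) := by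
  obtain ⟨t, hts, hspan, hind⟩ := exists_affineIndependent ℝ E s
  lift t to Finset E using hs.subset hts
  have hne : t.Nonempty := by
    rw [← Finset.coe_nonempty, ← affineSpan_nonempty (k := ℝ), hspan]
    exact ⟨y, hys⟩
  have hcard : t.card = (t.card - 1) + 1 := (Nat.succ_pred_eq_of_pos hne.card_pos).symm
  have hrank : Module.finrank ℝ (vectorSpan ℝ s) = t.card - 1 := by
    rw [← direction_affineSpan, ← hspan, direction_affineSpan]
    exact finrank_vectorSpan_of_card hind hcard
  by_contra! hlt
  exact hy t (hts.trans hsQ) (by omega) (hspan ▸ hys)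

theorem vectorSpan_image_eq_of_imageSign_ne_zero (hτ : AffineIndependent ℝ ((↑) : τ → E))
    (hsign : imageSign τ g ≠ 0) : vectorSpan ℝ (g '' τ) = vectorSpan ℝ (τ : Set E) := by
  obtain ⟨α, hα⟩ := exists_affineMap_eqOn hτ g
  exact (imageSign_ne_zero_iff hα (mapsTo_of_imageSign_ne_zero hsign)).1 hsign

theorem affineSpan_image_eq_of_imageSign_ne_zero (hτ : AffineIndependent ℝ ((↑) : τ → E))
    (hne : τ.Nonempty) (hsign : imageSign τ g ≠ 0) :
    affineSpan ℝ (g '' τ) = affineSpan ℝ (τ : Set E) := by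
  refine AffineSubspace.eq_of_direction_eq_of_nonempty_of_le ?_ ?_ ?_
  · rw [direction_affineSpan, direction_affineSpan,
      vectorSpan_image_eq_of_imageSign_ne_zero hτ hsign]
  · exact (affineSpan_nonempty ℝ).2 ((Finset.coe_nonempty.2 hne).image g)
  · exact affineSpan_le.2 (mapsTo_of_imageSign_ne_zero hsign).image_subset

theorem affineIndependent_image_of_imageSign_ne_zero (hτ : AffineIndependent ℝ ((↑) : τ → E))
    (hne : τ.Nonempty) (hsign : imageSign τ g ≠ 0) :
    AffineIndependent ℝ (fun v : τ => g v) := by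
  have hcard : τ.card = (τ.card - 1) + 1 := (Nat.succ_pred_eq_of_pos hne.card_pos).symm
  refine (affineIndependent_iff_finrank_vectorSpan_eq ℝ (fun v : τ => g v)
    (by rwa [Fintype.card_coe])).2 ?_
  rw [← finrank_vectorSpan_of_card hτ hcard, ← vectorSpan_image_eq_of_imageSign_ne_zero hτ hsign,
    image_eq_range]
  rfl

theorem imageSign_ne_zero_of_inGeneralPosition (hτ : AffineIndependent ℝ ((↑) : τ → E))
    (hcard : τ.card = d + 1) (hg : MapsTo g τ (affineSpan ℝ (τ : Set E))) (hgQ : MapsTo g τ Q)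
    (hy : InGeneralPosition d Q y) (hyg : y ∈ affineSpan ℝ (g '' τ)) : imageSign τ g ≠ 0 := by
  obtain ⟨α, hα⟩ := exists_affineMap_eqOn hτ g
  have := finiteDimensional_vectorSpan_of_finite ℝ τ.finite_toSet
  refine (imageSign_ne_zero_iff hα hg).2 (Submodule.eq_of_le_of_finrank_le ?_ ?_)
  · rw [← direction_affineSpan ℝ (τ : Set E)]
    exact vectorSpan_mono ℝ hg.image_subset
  · rw [finrank_vectorSpan_of_card hτ hcard]
    exact hy.le_finrank_vectorSpan (τ.finite_toSet.image g) hgQ.image_subset hyg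

open Classical in
/-- The contribution of the simplex `τ` to the signed number of image simplices covering `y`: the
orientation of the image of `τ` under `g` if that image contains `y`, and `0` otherwise. -/
noncomputable def coverSign (y : E) (g : E → E) (τ : Finset E) : ℤ :=
  if y ∈ convexHull ℝ (g '' τ) then imageSign τ g else 0

theorem coverSign_congr (h : EqOn g g' τ) : coverSign y g τ = coverSign y g' τ := by
  rw [coverSign, coverSign, h.image_eq, imageSign_congr h]

theorem mem_convexHull_of_coverSign_ne_zero (h : coverSign y g τ ≠ 0) :
    y ∈ convexHull ℝ (g '' τ) := by
  by_contra hy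
  exact h (if_neg hy)

theorem imageSign_ne_zero_of_coverSign_ne_zero (h : coverSign y g τ ≠ 0) : imageSign τ g ≠ 0 := by
  rwa [coverSign, if_pos (mem_convexHull_of_coverSign_ne_zero h)] at h

theorem mem_affineSpan_of_coverSign_ne_zero (h : coverSign y g τ ≠ 0) :
    y ∈ affineSpan ℝ (τ : Set E) :=
  have hmaps := mapsTo_of_imageSign_ne_zero (imageSign_ne_zero_of_coverSign_ne_zero h)
  convexHull_min hmaps.image_subset (affineSpan ℝ (τ : Set E)).convex
    (mem_convexHull_of_coverSign_ne_zero h)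

variable [DecidableEq E]

theorem coverSign_comp_swap (hτ : AffineIndependent ℝ ((↑) : τ → E))
    (hg : MapsTo g τ (affineSpan ℝ (τ : Set E))) {v w : E} (hv : v ∈ τ) (hw : w ∈ τ) (hvw : v ≠ w) :
    coverSign y (g ∘ Equiv.swap v w) τ = -coverSign y g τ := by
  have himage : Equiv.swap v w '' (τ : Set E) = τ :=
    ((Equiv.swap v w).image_eq_preimage_symm _).trans (by
      ext x
      rcases eq_or_ne x v with rfl | hxv
      · simp [hv, hw]
      rcases eq_or_ne x w with rfl | hxw
      · simp [hv, hw]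
      simp [Equiv.swap_apply_of_ne_of_ne hxv hxw])
  rw [coverSign, coverSign, image_comp, himage, imageSign_comp_swap hτ hg hv hw hvw]
  split_ifs <;> simp

theorem coverSign_eq_sum_update_of_imageSign_ne_zero (hτ : AffineIndependent ℝ ((↑) : τ → E))
    (hcard : τ.card = d + 1) (hgQ : MapsTo g τ Q) (hu : u ∈ affineSpan ℝ (τ : Set E))
    (huQ : u ∈ Q) (hy : InGeneralPosition d Q y) (hsign : imageSign τ g ≠ 0) :
    coverSign y g τ = ∑ w ∈ τ, coverSign y (Function.update g w u) τ := by
  have hne : τ.Nonempty := Finset.card_pos.1 (by omega)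
  have hspan := affineSpan_image_eq_of_imageSign_ne_zero hτ hne hsign
  by_cases hyτ : y ∈ affineSpan ℝ (τ : Set E)
  swap
  · have hzero : ∀ h, coverSign y h τ = 0 := fun h => by
      by_contra hh
      exact hyτ (mem_affineSpan_of_coverSign_ne_zero hh)
    simp only [hzero, Finset.sum_const_zero]
  obtain ⟨a, ha, rfl⟩ := mem_affineSpan_image_finset_iff.1 (hspan.symm ▸ hyτ)
  obtain ⟨c, hc, rfl⟩ := mem_affineSpan_image_finset_iff.1 (hspan.symm ▸ hu)
  have hcone := ite_mem_convexHull_range_eq_sum (Q := Q) (d := d) (p := fun v : τ => g v)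
    (a := fun v => a v) (c := fun v => c v)
    (affineIndependent_image_of_imageSign_ne_zero hτ hne hsign)
    (by rwa [Finset.sum_coe_sort τ a]) (by rwa [Finset.sum_coe_sort τ c])
    (by rw [Fintype.card_coe, hcard]) (by rintro - ⟨v, rfl⟩; exact hgQ v.2)
    (by rwa [Finset.sum_coe_sort τ fun v => c v • g v])
    (by rwa [Finset.sum_coe_sort τ fun v => a v • g v])
  have hrange : ∀ w q, range (Function.update (fun v : τ => g v) w q) =
      Function.update g w q '' τ := fun w q => by
    rw [← Function.update_comp_eq_of_injective' g Subtype.val_injective w q, image_eq_range]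
    rfl
  rw [Finset.sum_coe_sort τ fun v => a v • g v, Finset.sum_coe_sort τ fun v => c v • g v,
    show range (fun v : τ => g v) = g '' τ from (image_eq_range g τ).symm] at hcone
  set y := ∑ v ∈ τ, a v • g v
  classical
  calc coverSign y g τ = (if y ∈ convexHull ℝ (g '' τ) then 1 else 0) * imageSign τ g := by
        rw [coverSign, ite_mul, one_mul, zero_mul]
    _ = ∑ w : τ, coverSign y (Function.update g w (∑ v ∈ τ, c v • g v)) τ := by
        rw [hcone, Finset.sum_mul]
        refine Finset.sum_congr rfl fun w _ => ?_
        rw [coverSign, imageSign_update hτ (mapsTo_of_imageSign_ne_zero hsign) w.2 hc,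
          ← hrange]
        split_ifs
        · rw [mul_one]
        · rw [mul_zero, zero_mul]
    _ = _ := Finset.sum_coe_sort τ fun w => coverSign y (Function.update g w _) τ

theorem coverSign_eq_sum_update (hτ : AffineIndependent ℝ ((↑) : τ → E))
    (hcard : τ.card = d + 1) (hg : MapsTo g τ (affineSpan ℝ (τ : Set E))) (hgQ : MapsTo g τ Q)
    (hu : u ∈ affineSpan ℝ (τ : Set E)) (huQ : u ∈ Q) (hy : InGeneralPosition d Q y) :
    coverSign y g τ = ∑ w ∈ τ, coverSign y (Function.update g w u) τ := by
  by_cases hsign : imageSign τ g ≠ 0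
  · exact coverSign_eq_sum_update_of_imageSign_ne_zero hτ hcard hgQ hu huQ hy hsign
  have hzero : coverSign y g τ = 0 := by
    by_contra h
    exact hsign (imageSign_ne_zero_of_coverSign_ne_zero h)
  by_cases hall : ∀ w ∈ τ, coverSign y (Function.update g w u) τ = 0
  · rw [hzero, Finset.sum_eq_zero hall]
  obtain ⟨w₀, hw₀, hsign₀⟩ : ∃ w₀ ∈ τ, coverSign y (Function.update g w₀ u) τ ≠ 0 := by
    simpa using hall
  have hmaps : ∀ (A : Set E) (w : E), MapsTo g τ A → u ∈ A → MapsTo (Function.update g w u) τ A :=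
    fun A w hgA huA v hv => by
      rcases eq_or_ne v w with rfl | hvw <;> simp [*, hgA hv]
  have hswap : ∀ w, Function.update (Function.update g w₀ u) w (g w₀) =
      if w = w₀ then g else Function.update g w u ∘ Equiv.swap w w₀ := fun w => by
    split_ifs with hw
    · rw [hw, Function.update_idem, Function.update_eq_self]
    · ext v
      rcases eq_or_ne v w with rfl | hvw
      · simp [Ne.symm hw]
      rcases eq_or_ne v w₀ with rfl | hvw₀
      · simp [hvw]
      · simp [Equiv.swap_apply_of_ne_of_ne hvw hvw₀, hvw, hvw₀]
  have hcone := coverSign_eq_sum_update_of_imageSign_ne_zero hτ hcard (hmaps Q w₀ hgQ huQ)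
    (hg hw₀) (hgQ hw₀) hy (imageSign_ne_zero_of_coverSign_ne_zero hsign₀)
  rw [← Finset.add_sum_erase _ _ hw₀, hswap, if_pos rfl, hzero, zero_add] at hcone
  rw [hzero, ← Finset.add_sum_erase _ _ hw₀, hcone, ← Finset.sum_add_distrib]
  refine (Finset.sum_eq_zero fun w hw => ?_).symm
  obtain ⟨hne, hw⟩ := Finset.mem_erase.1 hw
  rw [hswap, if_neg hne, coverSign_comp_swap hτ (hmaps _ w hg hu) hw hw₀ hne, neg_add_cancel]

end CoverSign

section RelativeInterior

variable {E : Type*} [AddCommGroup E] [Module ℝ E] {C : Set E} {b x z : E}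

/-- `z` lies in the relative interior of the convex set `C`, expressed without a topology: every
affine functional that is nonnegative on `C` and not identically zero on `C` is positive at `z`. -/
def InRelativeInterior (C : Set E) (z : E) : Prop :=
  z ∈ C ∧ ∀ β : E →ᵃ[ℝ] ℝ, (∀ p ∈ C, 0 ≤ β p) → (∃ p ∈ C, β p ≠ 0) → 0 < β z

theorem InRelativeInterior.lineMap (hC : Convex ℝ C) (hb : InRelativeInterior C b) (hx : x ∈ C)
    {δ : ℝ} (hδ₀ : 0 < δ) (hδ₁ : δ ≤ 1) : InRelativeInterior C (AffineMap.lineMap x b δ) := by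
  refine ⟨hC.lineMap_mem hx hb.1 ⟨hδ₀.le, hδ₁⟩, fun β hβ hne => ?_⟩
  rw [AffineMap.apply_lineMap, AffineMap.lineMap_apply_module, smul_eq_mul, smul_eq_mul]
  exact add_pos_of_nonneg_of_pos (mul_nonneg (sub_nonneg.2 hδ₁) (hβ x hx))
    (mul_pos hδ₀ (hb.2 β hβ hne))

theorem InRelativeInterior.exists_neg (hz : InRelativeInterior C z) {β : E →ᵃ[ℝ] ℝ}
    (hβz : β z = 0) (hne : ∃ p ∈ C, β p ≠ 0) : ∃ p ∈ C, β p < 0 := by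
  by_contra! hβ
  exact (hz.2 β hβ hne).ne' hβz

theorem exists_inRelativeInterior_convexHull {s : Finset E} (hs : s.Nonempty) :
    ∃ b, InRelativeInterior (convexHull ℝ (s : Set E)) b := by
  have hcard : (0 : ℝ) < s.card := Nat.cast_pos.2 hs.card_pos
  have hsum : ∑ _v ∈ s, (s.card : ℝ)⁻¹ = 1 := by
    rw [Finset.sum_const, nsmul_eq_mul, mul_inv_cancel₀ hcard.ne']
  refine ⟨∑ v ∈ s, (s.card : ℝ)⁻¹ • v,
    Finset.mem_convexHull'.2 ⟨_, fun _ _ => (inv_pos.2 hcard).le, hsum, rfl⟩, fun β hβ hne => ?_⟩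
  have hβs : ∀ v ∈ s, 0 ≤ β v := fun v hv => hβ v (subset_convexHull ℝ _ hv)
  obtain ⟨v, hv, hβv⟩ : ∃ v ∈ s, β v ≠ 0 := by
    by_contra! hzero
    obtain ⟨p, hp, hβp⟩ := hne
    exact hβp (affineMap_eq_zero_of_mem_affineSpan hzero (convexHull_subset_affineSpan _ hp))
  rw [affineMap_sum_smul β _ hsum]
  exact Finset.sum_pos' (fun u hu => mul_nonneg (inv_pos.2 hcard).le (hβs u hu))
    ⟨v, hv, mul_pos (inv_pos.2 hcard) ((hβs v hv).lt_of_ne' hβv)⟩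

end RelativeInterior

section SimplicialComplex

variable {E : Type*} [AddCommGroup E] [Module ℝ E] {T : Geometry.SimplicialComplex ℝ E}
  {ρ τ : Finset E}

theorem subset_of_inRelativeInterior_mem_convexHull (hρ : ρ ∈ T.faces) (hτ : τ ∈ T.faces) {z : E}
    (hzρ : InRelativeInterior (convexHull ℝ (ρ : Set E)) z) (hzτ : z ∈ convexHull ℝ (τ : Set E)) :
    ρ ⊆ τ := by
  intro v hv
  by_contra hvτ
  obtain ⟨β, hβv, hβ⟩ := exists_affineMap_coord (T.indep hρ) hv
  have hβ_nonneg : ∀ u ∈ ρ, 0 ≤ β u := fun u hu => by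
    rcases eq_or_ne u v with rfl | huv
    · rw [hβv]; exact zero_le_one
    · exact (hβ u hu huv).ge
  refine (hzρ.2 β (fun p => affineMap_nonneg_of_mem_convexHull hβ_nonneg)
    ⟨v, subset_convexHull ℝ _ hv, by rw [hβv]; exact one_ne_zero⟩).ne' ?_
  refine affineMap_eq_zero_of_mem_affineSpan (s := ρ ∩ τ) ?_
    (convexHull_subset_affineSpan _ (T.inter_subset_convexHull hρ hτ ⟨hzρ.1, hzτ⟩))
  exact fun u ⟨huρ, huτ⟩ => hβ u huρ (ne_of_mem_of_not_mem huτ hvτ)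

/-- A common point is `w'` pushed far into the direction of `ρ`: adding a large multiple of the
vertices of `ρ` to `w'` makes all its coordinates with respect to `insert w ρ` nonnegative. -/
theorem exists_mem_convexHull_insert_inter {w w' : E} {c : E → ℝ} (hcw : 0 ≤ c w)
    (hc : c w + ∑ v ∈ ρ, c v = 1) (hw' : c w • w + ∑ v ∈ ρ, c v • v = w') :
    ∃ δ > 0, ∃ p ∈ convexHull ℝ (insert w (ρ : Set E)) ∩ convexHull ℝ (insert w' (ρ : Set E)),
      ∀ β : E →ᵃ[ℝ] ℝ, (∀ v ∈ ρ, β v = 0) → β p = δ * β w' := by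
  set K : ℝ := ∑ v ∈ ρ, |c v| with hK
  have hK_nonneg : 0 ≤ K := Finset.sum_nonneg fun v _ => abs_nonneg _
  have hcK : ∀ v ∈ ρ, 0 ≤ c v + K := fun v hv => by
    have := Finset.single_le_sum (fun u _ => abs_nonneg (c u)) hv
    linarith [neg_abs_le (c v)]
  set N : ℝ := 1 + ρ.card * K with hN
  have hN_pos : 0 < N := by positivity
  have hsum : N⁻¹ * c w + ∑ v ∈ ρ, N⁻¹ * (c v + K) = 1 := by
    rw [← Finset.mul_sum, Finset.sum_add_distrib, Finset.sum_const, nsmul_eq_mul, ← mul_add,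
      ← add_assoc, hc, inv_mul_cancel₀ hN_pos.ne']
  have hsum' : N⁻¹ + ∑ _v ∈ ρ, N⁻¹ * K = 1 := by
    rw [Finset.sum_const, nsmul_eq_mul, mul_left_comm, ← mul_one_add, inv_mul_cancel₀ hN_pos.ne']
  have hpp' : N⁻¹ • w' + ∑ v ∈ ρ, (N⁻¹ * K) • v =
      (N⁻¹ * c w) • w + ∑ v ∈ ρ, (N⁻¹ * (c v + K)) • v := by
    simp only [← hw', mul_add, add_smul, mul_smul, Finset.sum_add_distrib, smul_add,
      Finset.smul_sum, add_assoc]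
  refine ⟨N⁻¹, inv_pos.2 hN_pos, N⁻¹ • w' + ∑ v ∈ ρ, (N⁻¹ * K) • v, ⟨?_, ?_⟩, fun β hβ => ?_⟩
  · rw [hpp']
    exact add_sum_smul_mem_convexHull_insert (by positivity)
      (fun v hv => mul_nonneg (inv_pos.2 hN_pos).le (hcK v hv)) hsum
  · exact add_sum_smul_mem_convexHull_insert (by positivity) (fun v _ => by positivity) hsum'
  · rw [affineMap_add_sum_smul β hsum',
      Finset.sum_eq_zero fun v hv => by rw [hβ v hv, mul_zero], add_zero]

theorem apex_eq_of_same_side [DecidableEq E] {w w' : E} (hw : insert w ρ ∈ T.faces)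
    (hw' : insert w' ρ ∈ T.faces) (hmem : w' ∈ affineSpan ℝ ((insert w ρ : Finset E) : Set E))
    {β : E →ᵃ[ℝ] ℝ} (hβρ : ∀ v ∈ ρ, β v = 0) (hβ : 0 < β w * β w') : w = w' := by
  by_contra hne
  have hwρ : w ∉ ρ := fun h => by simp [hβρ w h] at hβ
  rw [← image_id ((insert w ρ : Finset E) : Set E), mem_affineSpan_image_finset_iff] at hmem
  obtain ⟨c, hc, hcw'⟩ := hmem
  simp only [Finset.sum_insert hwρ, id_eq] at hc hcw'
  have hcw : 0 < c w := by
    rw [← hcw', affineMap_add_sum_smul β hc,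
      Finset.sum_eq_zero fun v hv => by rw [hβρ v hv, mul_zero], add_zero, mul_left_comm] at hβ
    exact pos_of_mul_pos_left hβ (mul_self_nonneg _)
  obtain ⟨δ, hδ, p, hp, hβp⟩ := exists_mem_convexHull_insert_inter hcw.le hc hcw'
  rw [← Finset.coe_insert, ← Finset.coe_insert] at hp
  refine mul_ne_zero hδ.ne' (right_ne_zero_of_mul hβ.ne') ((hβp β hβρ).symm.trans ?_)
  refine affineMap_eq_zero_of_mem_affineSpan (fun v hv => ?_)
    (convexHull_subset_affineSpan _ (T.inter_subset_convexHull hw hw' hp))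
  rw [← Finset.coe_inter, Finset.mem_coe, Finset.mem_inter, Finset.mem_insert,
    Finset.mem_insert] at hv
  obtain ⟨rfl | hv, hv'⟩ := hv
  · exact hβρ _ (hv'.resolve_left hne)
  · exact hβρ v hv

end SimplicialComplex

section FiniteCovers

variable {ι E : Type*}

theorem lineMap_mem_of_lineMap_mem_of_ne [AddCommGroup E] [Module ℝ E] {A : AffineSubspace ℝ E}
    {x y : E} {t t' : ℝ} (hne : t ≠ t') (ht : AffineMap.lineMap x y t ∈ A)
    (ht' : AffineMap.lineMap x y t' ∈ A) (r : ℝ) : AffineMap.lineMap x y r ∈ A := by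
  have h := AffineMap.lineMap_mem ((r - t) / (t' - t)) ht ht'
  have hd : t' - t ≠ 0 := sub_ne_zero.2 hne.symm
  have hr : AffineMap.lineMap t t' ((r - t) / (t' - t)) = r := by
    rw [AffineMap.lineMap_apply, vsub_eq_sub, smul_eq_mul, vadd_eq_add, div_mul_cancel₀ _ hd,
      sub_add_cancel]
  rwa [← AffineMap.apply_lineMap, hr] at h

theorem exists_endpoints_mem_of_segment_subset_iUnion [AddCommGroup E] [Module ℝ E]
    {S : ι → AffineSubspace ℝ E} {F : Finset ι} {x y : E}
    (h : segment ℝ x y ⊆ ⋃ i ∈ F, (S i : Set E)) : ∃ i ∈ F, x ∈ S i ∧ y ∈ S i := by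
  have hmem : ∀ t ∈ Icc (0 : ℝ) 1, ∃ i ∈ F, AffineMap.lineMap x y t ∈ S i := fun t ht => by
    have := h (segment_eq_image_lineMap ℝ x y ▸ mem_image_of_mem _ ht)
    simpa only [mem_iUnion₂, SetLike.mem_coe, exists_prop] using this
  have : Nonempty ι := ⟨(hmem 0 ⟨le_rfl, zero_le_one⟩).choose⟩
  choose! f hfF hf using hmem
  obtain ⟨t, ht, t', ht', hne, heq⟩ := (Icc_infinite (zero_lt_one' ℝ)).exists_ne_map_eq_of_mapsTo
    (t := (F : Set ι)) hfF F.finite_toSet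
  have hline := lineMap_mem_of_lineMap_mem_of_ne hne (hf t ht) (heq ▸ hf t' ht')
  exact ⟨f t, hfF t ht, by simpa using hline 0, by simpa using hline 1⟩

theorem exists_subset_affineSubspace_of_subset_iUnion [AddCommGroup E] [Module ℝ E]
    {S : ι → AffineSubspace ℝ E} {C : Set E} (hC : Convex ℝ C) (hne : C.Nonempty) {F : Finset ι}
    (h : C ⊆ ⋃ i ∈ F, (S i : Set E)) : ∃ i ∈ F, C ⊆ S i := by
  classical
  induction F using Finset.induction_on with
  | empty =>
    obtain ⟨x, hx⟩ := hne
    simpa using h hx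
  | insert a F _ ih =>
    by_cases hF : C ⊆ ⋃ i ∈ F, (S i : Set E)
    · obtain ⟨i, hi, hCi⟩ := ih hF
      exact ⟨i, Finset.mem_insert_of_mem hi, hCi⟩
    obtain ⟨y, hy, hyF⟩ := not_subset.1 hF
    refine ⟨a, Finset.mem_insert_self _ _, fun x hx => ?_⟩
    obtain ⟨i, hi, hxi, hyi⟩ :=
      exists_endpoints_mem_of_segment_subset_iUnion ((hC.segment_subset hx hy).trans h)
    rcases Finset.mem_insert.1 hi with rfl | hiF
    · exact hxi
    · exact absurd (mem_iUnion₂.2 ⟨i, hiF, hyi⟩) hyF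

theorem exists_lineMap_of_eventually_nhds [NormedAddCommGroup E] [NormedSpace ℝ E] {a : E}
    {φ : E → Prop} (hφ : ∀ᶠ z in nhds a, φ z) (b : E) :
    ∃ δ : ℝ, 0 < δ ∧ δ ≤ 1 ∧ φ (AffineMap.lineMap a b δ) := by
  have hcont : Continuous fun δ : ℝ => (AffineMap.lineMap a b δ : E) := AffineMap.lineMap_continuous
  have htend : Filter.Tendsto (fun δ : ℝ => (AffineMap.lineMap a b δ : E))
      (nhdsWithin 0 (Ioi 0)) (nhds a) := by
    simpa using (hcont.tendsto 0).mono_left nhdsWithin_le_nhds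
  obtain ⟨δ, hδ, hδ_mem⟩ := ((htend.eventually hφ).and (Ioc_mem_nhdsGT (zero_lt_one' ℝ))).exists
  exact ⟨δ, hδ_mem.1, hδ_mem.2, hδ⟩

theorem eventually_nhds_forall_mem_of_isClosed [TopologicalSpace E] {K : ι → Set E}
    (hK : ∀ i, IsClosed (K i)) (F : Finset ι) (z : E) :
    ∀ᶠ z' in nhds z, ∀ i ∈ F, z' ∈ K i → z ∈ K i := by
  refine (Filter.eventually_all_finset F).2 fun i _ => ?_
  by_cases hz : z ∈ K i
  · exact Filter.Eventually.of_forall fun _ _ => hz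
  · filter_upwards [(hK i).isOpen_compl.mem_nhds hz] with z' hz' h
    exact absurd h hz'

variable [NormedAddCommGroup E] [NormedSpace ℝ E] {K : ι → Set E} {C : Set E} {F : Finset ι}

theorem exists_mem_subset_affineSpan_of_subset_iUnion (hK : ∀ i, IsClosed (K i))
    (hC : Convex ℝ C) (h : C ⊆ ⋃ i ∈ F, K i) {z : E} (hz : z ∈ C) :
    ∃ i ∈ F, z ∈ K i ∧ C ⊆ affineSpan ℝ (K i) := by
  classical
  obtain ⟨r, hr, hball⟩ :=
    Metric.eventually_nhds_iff_ball.1 (eventually_nhds_forall_mem_of_isClosed hK F z)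
  have hcover : C ∩ Metric.ball z r ⊆
      ⋃ i ∈ F.filter (z ∈ K ·), (affineSpan ℝ (K i) : Set E) := by
    rintro x ⟨hxC, hxr⟩
    obtain ⟨i, hi, hxi⟩ := mem_iUnion₂.1 (h hxC)
    exact mem_iUnion₂.2 ⟨i, Finset.mem_filter.2 ⟨hi, hball x hxr i hi hxi⟩,
      subset_affineSpan ℝ _ hxi⟩
  obtain ⟨i, hi, hsub⟩ := exists_subset_affineSubspace_of_subset_iUnion
    (hC.inter (convex_ball z r)) ⟨z, hz, Metric.mem_ball_self hr⟩ hcover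
  obtain ⟨hiF, hzi⟩ := Finset.mem_filter.1 hi
  refine ⟨i, hiF, hzi, fun x hx => ?_⟩
  obtain ⟨ε, hε₀, hε₁, hε⟩ := exists_lineMap_of_eventually_nhds (Metric.ball_mem_nhds z hr) x
  have hz' : AffineMap.lineMap z x (0 : ℝ) ∈ affineSpan ℝ (K i) := by
    simpa using subset_affineSpan ℝ _ hzi
  simpa using lineMap_mem_of_lineMap_mem_of_ne hε₀.ne hz'
    (hsub ⟨hC.lineMap_mem hz hx ⟨hε₀.le, hε₁⟩, hε⟩) 1

theorem exists_mem_lineMap_mem_of_subset_iUnion (hK : ∀ i, IsClosed (K i)) (hC : Convex ℝ C)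
    (h : C ⊆ ⋃ i ∈ F, K i) {p q : E} (hp : p ∈ C) (hq : q ∈ C) :
    ∃ i ∈ F, p ∈ K i ∧ (∃ δ : ℝ, 0 < δ ∧ δ ≤ 1 ∧ AffineMap.lineMap p q δ ∈ K i) ∧
      C ⊆ affineSpan ℝ (K i) := by
  obtain ⟨δ, hδ₀, hδ₁, hδ⟩ :=
    exists_lineMap_of_eventually_nhds (eventually_nhds_forall_mem_of_isClosed hK F p) q
  obtain ⟨i, hi, hzi, hCi⟩ := exists_mem_subset_affineSpan_of_subset_iUnion hK hC h
    (hC.lineMap_mem hp hq ⟨hδ₀.le, hδ₁⟩)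
  exact ⟨i, hi, hδ i hi hzi, ⟨δ, hδ₀, hδ₁, hzi⟩, hCi⟩

theorem isClosed_convexHull_finset (V : Finset E) : IsClosed (convexHull ℝ (V : Set E)) :=
  V.finite_toSet.isClosed_convexHull ℝ

end FiniteCovers

section AffineSpans

variable {E : Type*} [AddCommGroup E] [Module ℝ E]

theorem affineSpan_eq_of_le_of_finrank_le [FiniteDimensional ℝ E] {s t : Set E} (hs : s.Nonempty)
    (hle : affineSpan ℝ s ≤ affineSpan ℝ t)
    (hrank : Module.finrank ℝ (vectorSpan ℝ t) ≤ Module.finrank ℝ (vectorSpan ℝ s)) :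
    affineSpan ℝ s = affineSpan ℝ t := by
  have hdir := AffineSubspace.direction_le hle
  refine AffineSubspace.eq_of_direction_eq_of_nonempty_of_le
    (Submodule.eq_of_le_of_finrank_le hdir ?_) ((affineSpan_nonempty ℝ).2 hs) hle
  rwa [direction_affineSpan, direction_affineSpan]

theorem mem_affineSpan_of_mem_affineSpan_insert [DecidableEq E] {ρ : Finset E} {w p : E}
    (hp : p ∈ affineSpan ℝ ((insert w ρ : Finset E) : Set E)) {β : E →ᵃ[ℝ] ℝ} (hβw : β w ≠ 0)
    (hβρ : ∀ v ∈ ρ, β v = 0) (hβp : β p = 0) : p ∈ affineSpan ℝ (ρ : Set E) := by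
  have hw : w ∉ ρ := fun h => hβw (hβρ w h)
  rw [← image_id ((insert w ρ : Finset E) : Set E), mem_affineSpan_image_finset_iff] at hp
  obtain ⟨c, hc, rfl⟩ := hp
  simp only [Finset.sum_insert hw, id_eq] at hc hβp ⊢
  rw [affineMap_add_sum_smul β hc, Finset.sum_eq_zero fun v hv => by rw [hβρ v hv, mul_zero],
    add_zero] at hβp
  have hcw : c w = 0 := (mul_eq_zero.1 hβp).resolve_right hβw
  rw [hcw, zero_add] at hc
  rw [hcw, zero_smul, zero_add]
  exact sum_smul_mem_affineSubspace hc fun v hv => subset_affineSpan ℝ _ hv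

end AffineSpans

namespace Polytope

variable {d n : ℕ} {P : Polytope d n} {T : Geometry.SimplicialComplex ℝ (EuclideanSpace ℝ (Fin n))}
  {τ ρ V : Finset (EuclideanSpace ℝ (Fin n))} {x : EuclideanSpace ℝ (Fin n)}

theorem isClosed_space (P : Polytope d n) : IsClosed P.space :=
  P.cells.finite_toSet.isClosed_biUnion fun V _ => isClosed_convexHull_finset V

theorem mem_minimalCell (P : Polytope d n) (x : EuclideanSpace ℝ (Fin n)) : x ∈ P.minimalCell x :=
  mem_iInter₂.2 fun _ hV => hV.2

theorem minimalCell_subset (hV : V ∈ P.cells)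
    (hx : x ∈ convexHull ℝ (V : Set (EuclideanSpace ℝ (Fin n)))) :
    P.minimalCell x ⊆ convexHull ℝ (V : Set (EuclideanSpace ℝ (Fin n))) :=
  iInter₂_subset V ⟨hV, hx⟩

/-- A functional that is nonnegative on the minimal cell and vanishes at `x` exposes a face of the
cell through `x`, which by minimality is the whole cell. -/
theorem inRelativeInterior_minimalCell (hx : x ∈ P.space) :
    InRelativeInterior (P.minimalCell x) x := by
  obtain ⟨V, hV, -, hVM⟩ := P.exists_minimalCell_eq hx
  have hxM := P.mem_minimalCell x
  refine ⟨hxM, fun β hβ ⟨p, hp, hβp⟩ => (hβ x hxM).lt_of_ne' fun hβx => ?_⟩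
  have hlinear : ∀ q z, β.linear q ≤ β.linear z ↔ β q ≤ β z := fun q z => by
    rw [← sub_nonneg, ← sub_nonneg (b := β q), ← map_sub, ← vsub_eq_sub z q, β.linearMap_vsub,
      vsub_eq_sub]
  have hexposed : IsExposed ℝ (convexHull ℝ (V : Set (EuclideanSpace ℝ (Fin n))))
      {z ∈ P.minimalCell x | β z = 0} := by
    refine fun _ => ⟨-β.linear.toContinuousLinearMap, ?_⟩
    rw [hVM]
    ext z
    simp only [mem_ofPred_eq, neg_apply, LinearMap.coe_toContinuousLinearMap',
      neg_le_neg_iff, hlinear]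
    refine and_congr_right fun hz => ⟨fun hβz q hq => hβz ▸ hβ q hq, fun hmin => ?_⟩
    exact le_antisymm (hβx ▸ hmin x hxM) (hβ z hz)
  obtain ⟨W, hW, hWF⟩ := P.face_mem V hV {z ∈ P.minimalCell x | β z = 0} ⟨x, hxM, hβx⟩ hexposed
  have hxW : x ∈ convexHull ℝ (W : Set (EuclideanSpace ℝ (Fin n))) := by
    rw [hWF]
    exact ⟨hxM, hβx⟩
  have hpW := minimalCell_subset hW hxW hp
  rw [hWF] at hpW
  exact hβp hpW.2

namespace IsTriangulation

theorem convexHull_subset_iUnion_cells (hT : P.IsTriangulation T) (hτ : τ ∈ T.faces) :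
    convexHull ℝ (τ : Set (EuclideanSpace ℝ (Fin n))) ⊆
      ⋃ V ∈ P.cells, convexHull ℝ (V : Set (EuclideanSpace ℝ (Fin n))) :=
  (Geometry.SimplicialComplex.convexHull_subset_space hτ).trans hT.space_eq.subset

theorem convexHull_subset_iUnion_faces (hT : P.IsTriangulation T) (hV : V ∈ P.cells) :
    convexHull ℝ (V : Set (EuclideanSpace ℝ (Fin n))) ⊆
      ⋃ τ ∈ hT.finite.toFinset, convexHull ℝ (τ : Set (EuclideanSpace ℝ (Fin n))) := fun x hx => by
  have hxT : x ∈ T.space := hT.space_eq ▸ mem_iUnion₂.2 ⟨V, hV, hx⟩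
  obtain ⟨τ, hτ, hxτ⟩ := Geometry.SimplicialComplex.mem_space_iff.1 hxT
  exact mem_iUnion₂.2 ⟨τ, hT.finite.mem_toFinset.2 hτ, hxτ⟩

theorem exists_cell (hT : P.IsTriangulation T) (hτ : τ ∈ T.faces)
    (hx : x ∈ convexHull ℝ (τ : Set (EuclideanSpace ℝ (Fin n)))) :
    ∃ V ∈ P.cells, x ∈ convexHull ℝ (V : Set (EuclideanSpace ℝ (Fin n))) ∧
      affineSpan ℝ (τ : Set (EuclideanSpace ℝ (Fin n))) ≤
        affineSpan ℝ (V : Set (EuclideanSpace ℝ (Fin n))) := by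
  obtain ⟨V, hV, hxV, hle⟩ := exists_mem_subset_affineSpan_of_subset_iUnion
    isClosed_convexHull_finset (convex_convexHull ℝ _) (hT.convexHull_subset_iUnion_cells hτ) hx
  rw [← affineSpan_le, affineSpan_convexHull, affineSpan_convexHull] at hle
  exact ⟨V, hV, hxV, hle⟩

theorem card_le (hT : P.IsTriangulation T) (hτ : τ ∈ T.faces) : τ.card ≤ d + 1 := by
  obtain ⟨x, hx⟩ := Geometry.SimplicialComplex.nonempty_of_mem_faces hτ
  obtain ⟨V, hV, -, hle⟩ := hT.exists_cell hτ (subset_convexHull ℝ _ hx)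
  have hcard : τ.card = τ.card - 1 + 1 := (Nat.sub_add_cancel (Finset.card_pos.2 ⟨x, hx⟩)).symm
  have hfinrank := Submodule.finrank_mono (AffineSubspace.direction_le hle)
  rw [direction_affineSpan, direction_affineSpan,
    finrank_vectorSpan_of_card (T.indep hτ) hcard] at hfinrank
  have := P.dim_le V hV
  omega

theorem card_eq_of_affineSpan_le (hT : P.IsTriangulation T) {τ' : Finset _} (hτ : τ ∈ T.faces)
    (hcard : τ.card = d + 1) (hτ' : τ' ∈ T.faces)
    (hle : affineSpan ℝ (τ : Set (EuclideanSpace ℝ (Fin n))) ≤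
      affineSpan ℝ (τ' : Set (EuclideanSpace ℝ (Fin n)))) : τ'.card = d + 1 := by
  have hcard' : τ'.card = τ'.card - 1 + 1 := (Nat.sub_add_cancel (Finset.card_pos.2
    (Geometry.SimplicialComplex.nonempty_of_mem_faces hτ'))).symm
  have hfinrank := Submodule.finrank_mono (AffineSubspace.direction_le hle)
  rw [direction_affineSpan, direction_affineSpan, finrank_vectorSpan_of_card (T.indep hτ) hcard,
    finrank_vectorSpan_of_card (T.indep hτ') hcard'] at hfinrank
  have := hT.card_le hτ'
  omega

theorem minimalCell_subset_affineSpan (hT : P.IsTriangulation T) (hτ : τ ∈ T.faces)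
    (hcard : τ.card = d + 1) (hx : x ∈ τ) :
    P.minimalCell x ⊆ affineSpan ℝ (τ : Set (EuclideanSpace ℝ (Fin n))) := by
  obtain ⟨V, hV, hxV, hle⟩ := hT.exists_cell hτ (subset_convexHull ℝ _ hx)
  rw [affineSpan_eq_of_le_of_finrank_le ⟨x, hx⟩ hle
    ((P.dim_le V hV).trans (finrank_vectorSpan_of_card (T.indep hτ) hcard).ge)]
  exact (minimalCell_subset hV hxV).trans (convexHull_subset_affineSpan _)

theorem mem_space_of_mem (hT : P.IsTriangulation T) (hτ : τ ∈ T.faces) (hx : x ∈ τ) :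
    x ∈ P.space :=
  hT.space_eq ▸ T.subset_space hτ hx

theorem exists_mem_minimalCell_neg (hT : P.IsTriangulation T)
    [DecidableEq (EuclideanSpace ℝ (Fin n))] {w : EuclideanSpace ℝ (Fin n)}
    (hτ : insert w ρ ∈ T.faces) (hcard : (insert w ρ).card = d + 1)
    {β : EuclideanSpace ℝ (Fin n) →ᵃ[ℝ] ℝ} (hβρ : ∀ v ∈ ρ, β v = 0) (hβw : β w ≠ 0) (hx : x ∈ ρ)
    (hcell : ¬ P.minimalCell x ⊆ affineSpan ℝ (ρ : Set (EuclideanSpace ℝ (Fin n)))) :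
    ∃ m ∈ P.minimalCell x, β m < 0 := by
  have hxτ : x ∈ insert w ρ := Finset.mem_insert_of_mem hx
  obtain ⟨m, hm, hmρ⟩ := not_subset.1 hcell
  refine (inRelativeInterior_minimalCell (hT.mem_space_of_mem hτ hxτ)).exists_neg (hβρ x hx)
    ⟨m, hm, fun hβm => hmρ ?_⟩
  exact mem_affineSpan_of_mem_affineSpan_insert (hT.minimalCell_subset_affineSpan hτ hcard hxτ hm)
    hβw hβρ hβm

theorem exists_face_lineMap_mem (hT : P.IsTriangulation T) (hτ : τ ∈ T.faces)
    {b m : EuclideanSpace ℝ (Fin n)} (hx : x ∈ convexHull ℝ (τ : Set (EuclideanSpace ℝ (Fin n))))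
    (hb : b ∈ convexHull ℝ (τ : Set (EuclideanSpace ℝ (Fin n)))) (hm : m ∈ P.minimalCell x) :
    ∃ τ' ∈ T.faces, ∃ δ : ℝ, 0 < δ ∧ δ ≤ 1 ∧
      AffineMap.lineMap x b δ ∈ convexHull ℝ (τ' : Set (EuclideanSpace ℝ (Fin n))) ∧
      (∃ ε : ℝ, 0 < ε ∧ AffineMap.lineMap (AffineMap.lineMap x b δ) m ε ∈
        convexHull ℝ (τ' : Set (EuclideanSpace ℝ (Fin n)))) ∧
      affineSpan ℝ (τ : Set (EuclideanSpace ℝ (Fin n))) ≤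
        affineSpan ℝ (τ' : Set (EuclideanSpace ℝ (Fin n))) := by
  obtain ⟨V, hV, hxV, ⟨δ, hδ₀, hδ₁, hzV⟩, hτV⟩ := exists_mem_lineMap_mem_of_subset_iUnion
    isClosed_convexHull_finset (convex_convexHull ℝ _) (hT.convexHull_subset_iUnion_cells hτ) hx hb
  obtain ⟨τ', hτ', hzτ', ⟨ε, hε, -, hzε⟩, hVτ'⟩ := exists_mem_lineMap_mem_of_subset_iUnion
    isClosed_convexHull_finset (convex_convexHull ℝ _) (hT.convexHull_subset_iUnion_faces hV) hzV
    (minimalCell_subset hV hxV hm)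
  rw [← affineSpan_le, affineSpan_convexHull, affineSpan_convexHull] at hτV hVτ'
  exact ⟨τ', hT.finite.mem_toFinset.1 hτ', δ, hδ₀, hδ₁, hzτ', ⟨ε, hε, hzε⟩, hτV.trans hVτ'⟩

theorem exists_opposite_apex (hT : P.IsTriangulation T)
    [DecidableEq (EuclideanSpace ℝ (Fin n))] {w : EuclideanSpace ℝ (Fin n)}
    (hτ : insert w ρ ∈ T.faces) (hcard : (insert w ρ).card = d + 1)
    {β : EuclideanSpace ℝ (Fin n) →ᵃ[ℝ] ℝ} (hβρ : ∀ v ∈ ρ, β v = 0) (hβw : β w ≠ 0) (hx : x ∈ ρ)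
    (hcell : ¬ P.minimalCell x ⊆ affineSpan ℝ (ρ : Set (EuclideanSpace ℝ (Fin n)))) :
    ∃ w', insert w' ρ ∈ T.faces ∧
      affineSpan ℝ ((insert w' ρ : Finset _) : Set (EuclideanSpace ℝ (Fin n))) =
        affineSpan ℝ ((insert w ρ : Finset _) : Set (EuclideanSpace ℝ (Fin n))) ∧ β w' < 0 := by
  have hw : w ∉ ρ := fun h => hβw (hβρ w h)
  have hρτ : convexHull ℝ (ρ : Set (EuclideanSpace ℝ (Fin n))) ⊆
      convexHull ℝ ((insert w ρ : Finset _) : Set (EuclideanSpace ℝ (Fin n))) :=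
    convexHull_mono (Finset.coe_subset.2 (Finset.subset_insert w ρ))
  have hxρ := subset_convexHull ℝ (ρ : Set (EuclideanSpace ℝ (Fin n))) hx
  have hρ : ρ ∈ T.faces := T.down_closed hτ (Finset.subset_insert w ρ) ⟨x, hx⟩
  obtain ⟨m, hm, hβm⟩ := hT.exists_mem_minimalCell_neg hτ hcard hβρ hβw hx hcell
  obtain ⟨b, hb⟩ := exists_inRelativeInterior_convexHull (s := ρ) ⟨x, hx⟩
  obtain ⟨τ', hτ', δ, hδ₀, hδ₁, hzτ', ⟨ε, hε, hzε⟩, hle⟩ :=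
    hT.exists_face_lineMap_mem hτ (hρτ hxρ) (hρτ hb.1) hm
  have hz := hb.lineMap (convex_convexHull ℝ _) hxρ hδ₀ hδ₁
  have hcard' := hT.card_eq_of_affineSpan_le hτ hcard hτ' hle
  obtain ⟨w', -, rfl⟩ := Finset.exists_eq_insert_iff.2
    ⟨subset_of_inRelativeInterior_mem_convexHull hρ hτ' hz hzτ',
      by rw [hcard', ← hcard, Finset.card_insert_of_notMem hw]⟩
  refine ⟨w', hτ', (affineSpan_eq_of_le_of_finrank_le ⟨w, Finset.mem_insert_self w ρ⟩ hle ?_).symm,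
    ?_⟩
  · rw [finrank_vectorSpan_of_card (T.indep hτ) hcard,
      finrank_vectorSpan_of_card (T.indep hτ') hcard']
  by_contra! hβw'
  have hnonneg := affineMap_nonneg_of_mem_convexHull (β := β) (fun v hv => ?_) hzε
  · rw [AffineMap.apply_lineMap, AffineMap.lineMap_apply_module, affineMap_eq_zero_of_mem_affineSpan
      hβρ (convexHull_subset_affineSpan _ hz.1), smul_zero, zero_add, smul_eq_mul] at hnonneg
    exact (mul_neg_of_pos_of_neg hε hβm).not_ge hnonneg
  · rcases Finset.mem_insert.1 hv with rfl | hv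
    · exact hβw'
    · exact (hβρ v hv).ge

end IsTriangulation

end Polytope


section Apexes

variable {α : Type*} [DecidableEq α] {S : Finset (Finset α)} {ρ : Finset α} {v w : α}

/-- The apexes over `ρ` in the family `S` of simplices: the vertices `w` for which `ρ` is the facet
opposite to `w` of a simplex of `S`. -/
def apexes (S : Finset (Finset α)) (ρ : Finset α) : Finset α :=
  {w ∈ S.biUnion id | w ∉ ρ ∧ insert w ρ ∈ S}

theorem mem_apexes : w ∈ apexes S ρ ↔ w ∉ ρ ∧ insert w ρ ∈ S := by
  refine Finset.mem_filter.trans (and_iff_right_of_imp fun h => ?_)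
  exact Finset.mem_biUnion.2 ⟨insert w ρ, h.2, Finset.mem_insert_self w ρ⟩

theorem sum_erase_eq_sum_apexes {M : Type*} [AddCommMonoid M] (S : Finset (Finset α)) (v : α)
    (F : α → Finset α → M) :
    ∑ τ ∈ S with v ∈ τ, ∑ w ∈ τ.erase v, F w τ =
      ∑ ρ ∈ S.biUnion Finset.powerset with v ∈ ρ, ∑ w ∈ apexes S ρ, F w (insert w ρ) := by
  rw [Finset.sum_sigma', Finset.sum_sigma']
  refine Finset.sum_nbij' (fun p => ⟨p.1.erase p.2, p.2⟩) (fun p => ⟨insert p.2 p.1, p.2⟩)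
    ?_ ?_ ?_ ?_ ?_
  · rintro ⟨τ, w⟩ h
    simp only [Finset.mem_sigma, Finset.mem_filter, Finset.mem_erase] at h
    obtain ⟨⟨hτ, hv⟩, hwv, hw⟩ := h
    simp only [Finset.mem_sigma, Finset.mem_filter, Finset.mem_biUnion, Finset.mem_powerset,
      Finset.mem_erase, mem_apexes, Finset.insert_erase hw]
    exact ⟨⟨⟨τ, hτ, Finset.erase_subset w τ⟩, hwv.symm, hv⟩, fun h => h.1 rfl, hτ⟩
  · rintro ⟨ρ, w⟩ h
    simp only [Finset.mem_sigma, Finset.mem_filter, mem_apexes] at h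
    obtain ⟨⟨-, hv⟩, hw, hwρ⟩ := h
    simp only [Finset.mem_sigma, Finset.mem_filter, Finset.mem_erase]
    exact ⟨⟨hwρ, Finset.mem_insert_of_mem hv⟩, ne_of_mem_of_not_mem hv hw |>.symm,
      Finset.mem_insert_self w ρ⟩
  · rintro ⟨τ, w⟩ h
    rw [Finset.insert_erase (Finset.mem_of_mem_erase (Finset.mem_sigma.1 h).2)]
  · rintro ⟨ρ, w⟩ h
    rw [Finset.erase_insert (mem_apexes.1 (Finset.mem_sigma.1 h).2).1]
  · rintro ⟨τ, w⟩ h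
    rw [Finset.insert_erase (Finset.mem_of_mem_erase (Finset.mem_sigma.1 h).2)]

end Apexes

section CoverSignExchange

variable {E : Type*} [AddCommGroup E] [Module ℝ E] [DecidableEq E] {ρ : Finset E}
  {w w' y u : E} {g : E → E}

theorem coverSign_exchange (hw : w ∉ ρ) (hw' : w' ∉ ρ)
    (hind : AffineIndependent ℝ ((↑) : ↥(insert w ρ) → E))
    (hspan : affineSpan ℝ ((insert w' ρ : Finset E) : Set E) =
      affineSpan ℝ ((insert w ρ : Finset E) : Set E))
    (hg : MapsTo (Function.update g w u) ((insert w ρ : Finset E) : Set E)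
      (affineSpan ℝ ((insert w ρ : Finset E) : Set E)))
    {β : E →ᵃ[ℝ] ℝ} (hβρ : ∀ v ∈ ρ, β v = 0) (hβ : β w * β w' < 0) :
    coverSign y (Function.update g w' u) (insert w' ρ) =
      -coverSign y (Function.update g w u) (insert w ρ) := by
  have himage : ∀ x ∉ ρ, Function.update g x u '' ((insert x ρ : Finset E) : Set E) =
      insert u (g '' ρ) := fun x hx => by
    rw [Finset.coe_insert, image_insert_eq, Function.update_self]
    exact congrArg (insert u) (image_congr fun v hv =>
      Function.update_of_ne (ne_of_mem_of_not_mem hv hx) u g)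
  rw [coverSign, coverSign, himage w hw, himage w' hw',
    imageSign_exchange hw hw' hind hspan hg hβρ hβ]
  split_ifs <;> simp

theorem mem_affineSpan_insert_of_mem_affineSpan_insert (hρ : ρ.Nonempty)
    (hyw' : y ∈ affineSpan ℝ ((insert w' ρ : Finset E) : Set E))
    (hyw : y ∈ affineSpan ℝ ((insert w ρ : Finset E) : Set E))
    (hy : y ∉ affineSpan ℝ (ρ : Set E)) :
    w' ∈ affineSpan ℝ ((insert w ρ : Finset E) : Set E) := by
  obtain ⟨p, hp⟩ := hρ
  have hp := subset_affineSpan ℝ (ρ : Set E) hp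
  rw [Finset.coe_insert, ← affineSpan_insert_affineSpan,
    AffineSubspace.mem_affineSpan_insert_iff hp] at hyw'
  obtain ⟨r, q, hq, hyq⟩ := hyw'
  have hr : r ≠ 0 := by
    rintro rfl
    rw [zero_smul, zero_vadd] at hyq
    exact hy (hyq ▸ hq)
  have hle : affineSpan ℝ (ρ : Set E) ≤ affineSpan ℝ ((insert w ρ : Finset E) : Set E) :=
    affineSpan_mono ℝ (Finset.coe_subset.2 (Finset.subset_insert w ρ))
  have hw' : w' = r⁻¹ • (y -ᵥ q) +ᵥ p := by
    rw [hyq, vadd_vsub, inv_smul_smul₀ hr, vsub_vadd]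
  rw [hw']
  exact AffineSubspace.smul_vsub_vadd_mem _ r⁻¹ hyw (hle hq) (hle hp)

end CoverSignExchange

theorem mem_vertices_of_mem_face {E : Type*} [AddCommGroup E] [Module ℝ E]
    {T : Geometry.SimplicialComplex ℝ E} {τ : Finset E} {v : E} (hτ : τ ∈ T.faces) (hv : v ∈ τ) :
    v ∈ T.vertices :=
  T.vertices_eq ▸ mem_iUnion₂.2 ⟨τ, hτ, hv⟩

theorem apex_eq_or_eq_of_opposite_sides {E : Type*} [AddCommGroup E] [Module ℝ E]
    [DecidableEq E] {T : Geometry.SimplicialComplex ℝ E} {ρ : Finset E} {w w' w₁ : E}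
    (hw : insert w ρ ∈ T.faces) (hw' : insert w' ρ ∈ T.faces) (hw₁ : insert w₁ ρ ∈ T.faces)
    (hw₁ρ : w₁ ∉ ρ)
    (hspan : affineSpan ℝ ((insert w' ρ : Finset E) : Set E) =
      affineSpan ℝ ((insert w ρ : Finset E) : Set E))
    (hmem : w₁ ∈ affineSpan ℝ ((insert w ρ : Finset E) : Set E))
    {β : E →ᵃ[ℝ] ℝ} (hβρ : ∀ v ∈ ρ, β v = 0) (hβw : 0 < β w) (hβw' : β w' < 0) :
    w₁ = w ∨ w₁ = w' := by
  rcases lt_trichotomy (β w₁) 0 with hneg | hβw₁ | hpos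
  · exact Or.inr (apex_eq_of_same_side hw' hw₁ (hspan ▸ hmem) hβρ
      (mul_pos_of_neg_of_neg hβw' hneg)).symm
  · obtain ⟨β₁, hβ₁w₁, hβ₁⟩ := exists_affineMap_coord (T.indep hw₁) (Finset.mem_insert_self w₁ ρ)
    refine absurd (affineMap_eq_zero_of_mem_affineSpan (s := (ρ : Set E)) (fun x hx =>
      hβ₁ x (Finset.mem_insert_of_mem hx) (ne_of_mem_of_not_mem hx hw₁ρ)) ?_)
      (hβ₁w₁.trans_ne one_ne_zero)
    exact mem_affineSpan_of_mem_affineSpan_insert hmem hβw.ne' hβρ hβw₁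
  · exact Or.inl (apex_eq_of_same_side hw hw₁ hmem hβρ (mul_pos hβw hpos)).symm

namespace Polytope.IsTriangulation

variable {d n : ℕ} {P : Polytope d n} {T : Geometry.SimplicialComplex ℝ (EuclideanSpace ℝ (Fin n))}

/-- The `d`-dimensional simplices of `T`, given by their vertex sets. -/
noncomputable def topSimplices (hT : P.IsTriangulation T) :
    Finset (Finset (EuclideanSpace ℝ (Fin n))) :=
  {τ ∈ hT.finite.toFinset | τ.card = d + 1}

variable {ρ τ : Finset (EuclideanSpace ℝ (Fin n))} {Q : Set (EuclideanSpace ℝ (Fin n))}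
  {u v w y : EuclideanSpace ℝ (Fin n)} {g : EuclideanSpace ℝ (Fin n) → EuclideanSpace ℝ (Fin n)}

theorem mem_topSimplices (hT : P.IsTriangulation T) :
    τ ∈ hT.topSimplices ↔ τ ∈ T.faces ∧ τ.card = d + 1 := by
  rw [topSimplices, Finset.mem_filter, hT.finite.mem_toFinset]

variable [DecidableEq (EuclideanSpace ℝ (Fin n))]

theorem exists_opposite_apex_of_coverSign_ne_zero (hT : P.IsTriangulation T)
    (hτ : insert w ρ ∈ T.faces) (hcard : (insert w ρ).card = d + 1)
    {β : EuclideanSpace ℝ (Fin n) →ᵃ[ℝ] ℝ} (hβρ : ∀ v ∈ ρ, β v = 0) (hβw : β w ≠ 0) (hv : v ∈ ρ)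
    (hu : u ∈ affineSpan ℝ (P.minimalCell v))
    (hg : ∀ x ∈ ρ, g x ∈ affineSpan ℝ (P.minimalCell x))
    (hne : coverSign y (Function.update g w u) (insert w ρ) ≠ 0) :
    ∃ w', insert w' ρ ∈ T.faces ∧
      affineSpan ℝ ((insert w' ρ : Finset _) : Set (EuclideanSpace ℝ (Fin n))) =
        affineSpan ℝ ((insert w ρ : Finset _) : Set (EuclideanSpace ℝ (Fin n))) ∧ β w' < 0 := by
  obtain ⟨x, hx, hcell⟩ : ∃ x ∈ ρ, ¬ P.minimalCell x ⊆
      affineSpan ℝ (ρ : Set (EuclideanSpace ℝ (Fin n))) := by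
    by_contra! hcells
    have himage : MapsTo (Function.update g w u) ((insert w ρ : Finset _) : Set _)
        (affineSpan ℝ (ρ : Set (EuclideanSpace ℝ (Fin n)))) := fun x hx => by
      rcases eq_or_ne x w with rfl | hxw
      · rw [Function.update_self]
        exact affineSpan_le.2 (hcells v hv) hu
      · rw [Function.update_of_ne hxw]
        have hxρ := Finset.mem_of_mem_insert_of_ne hx hxw
        exact affineSpan_le.2 (hcells x hxρ) (hg x hxρ)
    have hspan := affineSpan_image_eq_of_imageSign_ne_zero (T.indep hτ) ⟨w, by simp⟩
      (imageSign_ne_zero_of_coverSign_ne_zero hne)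
    have hw : w ∈ affineSpan ℝ ((insert w ρ : Finset _) : Set (EuclideanSpace ℝ (Fin n))) :=
      subset_affineSpan ℝ _ (by simp)
    exact hβw (affineMap_eq_zero_of_mem_affineSpan hβρ
      (affineSpan_le.2 himage.image_subset (hspan ▸ hw)))
  exact hT.exists_opposite_apex hτ hcard hβρ hβw hx hcell

theorem sum_apexes_coverSign_eq_zero (hT : P.IsTriangulation T) (hy : InGeneralPosition d Q y)
    (hQ : T.vertices ⊆ Q) (hv : v ∈ ρ) (hu : u ∈ affineSpan ℝ (P.minimalCell v))
    (hg : ∀ x ∈ ρ, g x ∈ affineSpan ℝ (P.minimalCell x)) :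
    ∑ w ∈ apexes hT.topSimplices ρ, coverSign y (Function.update g w u) (insert w ρ) = 0 := by
  by_cases hzero : ∀ w ∈ apexes hT.topSimplices ρ,
    coverSign y (Function.update g w u) (insert w ρ) = 0
  · exact Finset.sum_eq_zero hzero
  push Not at hzero
  obtain ⟨w, hw, hne⟩ := hzero
  obtain ⟨hwρ, hwS⟩ := mem_apexes.1 hw
  obtain ⟨hτ, hcard⟩ := hT.mem_topSimplices.1 hwS
  have hρcard : ρ.card = d := by rwa [Finset.card_insert_of_notMem hwρ, add_left_inj] at hcard
  have hρ : ρ ∈ T.faces := T.down_closed hτ (Finset.subset_insert w ρ) ⟨v, hv⟩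
  obtain ⟨β, hβw, hβ⟩ := exists_affineMap_coord (T.indep hτ) (Finset.mem_insert_self w ρ)
  have hβρ : ∀ x ∈ ρ, β x = 0 := fun x hx =>
    hβ x (Finset.mem_insert_of_mem hx) (ne_of_mem_of_not_mem hx hwρ)
  obtain ⟨w', hτ', hspan, hβw'⟩ := hT.exists_opposite_apex_of_coverSign_ne_zero hτ hcard hβρ
    (hβw.trans_ne one_ne_zero) hv hu hg hne
  have hw'ρ : w' ∉ ρ := fun h => hβw'.ne (hβρ w' h)
  have hw' : w' ∈ apexes hT.topSimplices ρ := mem_apexes.2 ⟨hw'ρ, hT.mem_topSimplices.2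
    ⟨hτ', by rw [Finset.card_insert_of_notMem hw'ρ, hρcard]⟩⟩
  have hww' : w ≠ w' := by
    rintro rfl
    exact hβw'.not_ge (hβw ▸ zero_le_one)
  have hother : ∀ w₁ ∈ apexes hT.topSimplices ρ, w₁ ≠ w ∧ w₁ ≠ w' →
      coverSign y (Function.update g w₁ u) (insert w₁ ρ) = 0 := fun w₁ hw₁ hne₁ => by
    by_contra hcover
    obtain ⟨hw₁ρ, hw₁S⟩ := mem_apexes.1 hw₁
    have hyρ : y ∉ affineSpan ℝ (ρ : Set (EuclideanSpace ℝ (Fin n))) :=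
      hy ρ (fun x hx => hQ (mem_vertices_of_mem_face hρ hx)) hρcard.le
    have hmem := mem_affineSpan_insert_of_mem_affineSpan_insert ⟨v, hv⟩
      (mem_affineSpan_of_coverSign_ne_zero hcover) (mem_affineSpan_of_coverSign_ne_zero hne) hyρ
    exact (apex_eq_or_eq_of_opposite_sides hτ hτ' (hT.mem_topSimplices.1 hw₁S).1 hw₁ρ hspan hmem
      hβρ (hβw ▸ one_pos) hβw').elim hne₁.1 hne₁.2
  rw [Finset.sum_eq_add_of_mem w w' hw hw' hww' hother,
    coverSign_exchange hwρ hw'ρ (T.indep hτ) hspan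
      (mapsTo_of_imageSign_ne_zero (imageSign_ne_zero_of_coverSign_ne_zero hne)) hβρ
      (by rwa [hβw, one_mul]), add_neg_cancel]

end Polytope.IsTriangulation

namespace Polytope.IsTriangulation

variable {d n : ℕ} {P : Polytope d n} {T : Geometry.SimplicialComplex ℝ (EuclideanSpace ℝ (Fin n))}
  {Q : Set (EuclideanSpace ℝ (Fin n))} {u v y : EuclideanSpace ℝ (Fin n)}
  {g : EuclideanSpace ℝ (Fin n) → EuclideanSpace ℝ (Fin n)}

theorem coverSign_eq_coverSign_update_add [DecidableEq (EuclideanSpace ℝ (Fin n))]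
    (hT : P.IsTriangulation T) (hy : InGeneralPosition d Q y)
    (hg : ∀ x ∈ T.vertices, g x ∈ affineSpan ℝ (P.minimalCell x)) (hgQ : MapsTo g T.vertices Q)
    (hu : u ∈ affineSpan ℝ (P.minimalCell v)) (huQ : u ∈ Q)
    {τ : Finset (EuclideanSpace ℝ (Fin n))} (hτ : τ ∈ hT.topSimplices) :
    coverSign y g τ = coverSign y (Function.update g v u) τ +
      if v ∈ τ then ∑ w ∈ τ.erase v, coverSign y (Function.update g w u) τ else 0 := by
  obtain ⟨hτ, hcard⟩ := hT.mem_topSimplices.1 hτ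
  have hcell : ∀ x ∈ τ, affineSpan ℝ (P.minimalCell x) ≤
      affineSpan ℝ (τ : Set (EuclideanSpace ℝ (Fin n))) := fun x hx =>
    affineSpan_le.2 (hT.minimalCell_subset_affineSpan hτ hcard hx)
  split_ifs with hv
  · rw [Finset.add_sum_erase τ (fun w => coverSign y (Function.update g w u) τ) hv]
    exact coverSign_eq_sum_update (T.indep hτ) hcard
      (fun x hx => hcell x hx (hg x (mem_vertices_of_mem_face hτ hx)))
      (fun x hx => hgQ (mem_vertices_of_mem_face hτ hx)) (hcell v hv hu) huQ hy
  · rw [add_zero]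
    exact coverSign_congr fun x hx =>
      (Function.update_of_ne (ne_of_mem_of_not_mem hx hv) u g).symm

theorem sum_coverSign_update [DecidableEq (EuclideanSpace ℝ (Fin n))]
    (hT : P.IsTriangulation T) (hy : InGeneralPosition d Q y) (hQ : T.vertices ⊆ Q)
    (hg : ∀ x ∈ T.vertices, g x ∈ affineSpan ℝ (P.minimalCell x)) (hgQ : MapsTo g T.vertices Q)
    (hu : u ∈ affineSpan ℝ (P.minimalCell v)) (huQ : u ∈ Q) :
    ∑ τ ∈ hT.topSimplices, coverSign y (Function.update g v u) τ =
      ∑ τ ∈ hT.topSimplices, coverSign y g τ := by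
  rw [Finset.sum_congr rfl fun τ hτ =>
      hT.coverSign_eq_coverSign_update_add hy hg hgQ hu huQ hτ, Finset.sum_add_distrib,
    left_eq_add, ← Finset.sum_filter, sum_erase_eq_sum_apexes]
  refine Finset.sum_eq_zero fun ρ hρ => ?_
  obtain ⟨hρ, hv⟩ := Finset.mem_filter.1 hρ
  obtain ⟨τ, hτ, hρτ⟩ := Finset.mem_biUnion.1 hρ
  exact hT.sum_apexes_coverSign_eq_zero hy hQ hv hu fun x hx =>
    hg x (mem_vertices_of_mem_face (hT.mem_topSimplices.1 hτ).1 (Finset.mem_powerset.1 hρτ hx))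

theorem finite_vertices (hT : P.IsTriangulation T) : T.vertices.Finite :=
  hT.finite.preimage Finset.singleton_injective.injOn

theorem sum_coverSign_eq_sum_coverSign_id (hT : P.IsTriangulation T)
    (hy : InGeneralPosition d Q y) (hQ : T.vertices ⊆ Q)
    (hg : ∀ x ∈ T.vertices, g x ∈ affineSpan ℝ (P.minimalCell x)) (hgQ : MapsTo g T.vertices Q) :
    ∑ τ ∈ hT.topSimplices, coverSign y g τ = ∑ τ ∈ hT.topSimplices, coverSign y id τ := by
  classical
  have hpartial : ∀ U : Finset (EuclideanSpace ℝ (Fin n)), ↑U ⊆ T.vertices →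
      ∑ τ ∈ hT.topSimplices, coverSign y (U.piecewise g id) τ =
        ∑ τ ∈ hT.topSimplices, coverSign y id τ := fun U => by
    induction U using Finset.induction_on with
    | empty => simp
    | insert v U _ ih =>
      intro hU
      rw [Finset.coe_insert, insert_subset_iff] at hU
      rw [Finset.piecewise_insert, hT.sum_coverSign_update hy hQ (fun x hx => ?_) (fun x hx => ?_)
        (hg v hU.1) (hgQ hU.1), ih hU.2]
      · by_cases hxU : x ∈ U
        · simpa [hxU] using hg x hx
        · simpa [hxU] using subset_affineSpan ℝ _ (P.mem_minimalCell x)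
      · by_cases hxU : x ∈ U
        · simpa [hxU] using hgQ hx
        · simpa [hxU] using hQ hx
  rw [← hpartial hT.finite_vertices.toFinset (by simp)]
  refine Finset.sum_congr rfl fun τ hτ => coverSign_congr fun v hv => ?_
  rw [Finset.piecewise_eq_of_mem _ _ _ (hT.finite_vertices.mem_toFinset.2
    (mem_vertices_of_mem_face (hT.mem_topSimplices.1 hτ).1 hv))]

theorem exists_topSimplex_mem_convexHull (hT : P.IsTriangulation T)
    (hy : InGeneralPosition d T.vertices y) (hyP : y ∈ P.space) :
    ∃ τ ∈ hT.topSimplices, y ∈ convexHull ℝ (τ : Set (EuclideanSpace ℝ (Fin n))) := by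
  obtain ⟨τ, hτ, hyτ⟩ := Geometry.SimplicialComplex.mem_space_iff.1 (hT.space_eq ▸ hyP)
  refine ⟨τ, hT.mem_topSimplices.2 ⟨hτ, (hT.card_le hτ).antisymm ?_⟩, hyτ⟩
  by_contra! hlt
  exact hy τ (fun x hx => mem_vertices_of_mem_face hτ hx) (Nat.lt_succ_iff.1 hlt)
    (convexHull_subset_affineSpan _ hyτ)

theorem topSimplex_unique (hT : P.IsTriangulation T) (hy : InGeneralPosition d T.vertices y)
    {τ τ' : Finset (EuclideanSpace ℝ (Fin n))} (hτ : τ ∈ hT.topSimplices)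
    (hτ' : τ' ∈ hT.topSimplices) (hyτ : y ∈ convexHull ℝ (τ : Set (EuclideanSpace ℝ (Fin n))))
    (hyτ' : y ∈ convexHull ℝ (τ' : Set (EuclideanSpace ℝ (Fin n)))) : τ = τ' := by
  classical
  obtain ⟨hτ, hcard⟩ := hT.mem_topSimplices.1 hτ
  obtain ⟨hτ', hcard'⟩ := hT.mem_topSimplices.1 hτ'
  have hinter := convexHull_subset_affineSpan _ (T.inter_subset_convexHull hτ hτ' ⟨hyτ, hyτ'⟩)
  rw [← Finset.coe_inter] at hinter
  have hle : d + 1 ≤ (τ ∩ τ').card := by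
    by_contra! hlt
    exact hy (τ ∩ τ') (fun x hx => mem_vertices_of_mem_face hτ (Finset.mem_inter.1 hx).1)
      (Nat.lt_succ_iff.1 hlt) hinter
  exact (Finset.eq_of_subset_of_card_le Finset.inter_subset_left (hcard.trans_le hle)).symm.trans
    (Finset.eq_of_subset_of_card_le Finset.inter_subset_right (hcard'.trans_le hle))

theorem sum_coverSign_id (hT : P.IsTriangulation T) (hy : InGeneralPosition d T.vertices y)
    (hyP : y ∈ P.space) : ∑ τ ∈ hT.topSimplices, coverSign y id τ = 1 := by
  obtain ⟨τ₀, hτ₀, hyτ₀⟩ := hT.exists_topSimplex_mem_convexHull hy hyP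
  rw [Finset.sum_eq_single_of_mem τ₀ hτ₀ fun τ hτ hne => ?_]
  · rw [coverSign, image_id, if_pos hyτ₀, imageSign_id]
  · rw [coverSign, image_id, if_neg fun hyτ => hne (hT.topSimplex_unique hy hτ hτ₀ hyτ hyτ₀)]

theorem sum_coverSign_eq_one (hT : P.IsTriangulation T)
    (hg : ∀ x ∈ T.vertices, g x ∈ affineSpan ℝ (P.minimalCell x))
    (hy : InGeneralPosition d (T.vertices ∪ g '' T.vertices) y) (hyP : y ∈ P.space) :
    ∑ τ ∈ hT.topSimplices, coverSign y g τ = 1 := by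
  rw [hT.sum_coverSign_eq_sum_coverSign_id hy subset_union_left hg
    fun x hx => Or.inr (mem_image_of_mem g hx)]
  exact hT.sum_coverSign_id (fun s hs => hy s (hs.trans subset_union_left)) hyP

end Polytope.IsTriangulation

section NullSets

variable {E : Type*} [NormedAddCommGroup E] [NormedSpace ℝ E] [MeasurableSpace E] [BorelSpace E]
  {d : ℕ}

theorem euclideanHausdorffMeasure_affineSubspace_eq_zero {A : AffineSubspace ℝ E}
    [FiniteDimensional ℝ A.direction] (hA : Module.finrank ℝ A.direction < d) :
    (μHE[d] : Measure E) A = 0 := by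
  rcases (A : Set E).eq_empty_or_nonempty with hempty | ⟨p, hp⟩
  · rw [hempty, measure_empty]
  have hiso : Isometry fun v : A.direction => (v : E) + p :=
    Isometry.of_dist_eq fun v w => by rw [dist_add_right, Subtype.dist_eq]
  have hrange : (A : Set E) ⊆ (fun v : A.direction => (v : E) + p) '' univ := fun x hx =>
    ⟨⟨x - p, A.vsub_mem_direction hx hp⟩, mem_univ _, sub_add_cancel x p⟩
  refine measure_mono_null hrange ?_
  rw [hiso.euclideanHausdorffMeasure_image, Measure.euclideanHausdorffMeasure_def,
    Measure.smul_apply, Real.hausdorffMeasure_of_finrank_lt (E := A.direction)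
      (by exact_mod_cast hA), Measure.coe_zero, Pi.zero_apply, smul_zero]

theorem euclideanHausdorffMeasure_affineSpan_finset_eq_zero {s : Finset E} (hs : s.card ≤ d) :
    (μHE[d] : Measure E) (affineSpan ℝ (s : Set E)) = 0 := by
  rcases s.eq_empty_or_nonempty with rfl | hne
  · simp
  have := finiteDimensional_direction_affineSpan_of_finite ℝ s.finite_toSet
  refine euclideanHausdorffMeasure_affineSubspace_eq_zero ?_
  have := hne.to_subtype
  have hle := finrank_vectorSpan_range_add_one_le ℝ ((↑) : s → E)
  rw [Fintype.card_coe] at hle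
  rw [direction_affineSpan, show (s : Set E) = range ((↑) : s → E) from Subtype.range_coe.symm]
  exact Nat.lt_of_succ_le (hle.trans hs)

theorem ae_inGeneralPosition {Q : Set E} (hQ : Q.Finite) :
    ∀ᵐ y ∂(μHE[d] : Measure E), InGeneralPosition d Q y := by
  lift Q to Finset E using hQ
  have hae : ∀ᵐ y ∂(μHE[d] : Measure E), ∀ s ∈ Q.powerset, s.card ≤ d →
      y ∉ affineSpan ℝ (s : Set E) :=
    (Filter.eventually_all_finset _).2 fun s _ => Filter.eventually_imp_distrib_left.2 fun hs =>
      measure_eq_zero_iff_ae_notMem.1 (euclideanHausdorffMeasure_affineSpan_finset_eq_zero hs)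
  filter_upwards [hae] with y hy s hsQ hs using
    hy s (Finset.mem_powerset.2 (Finset.coe_subset.1 hsQ)) hs

end NullSets

section VertexHomotopy

variable {E : Type*} [AddCommGroup E] [Module ℝ E] {T : Geometry.SimplicialComplex ℝ E}
  {γ : E → I → E} {t : I} {τ : Finset E} {v : E}

theorem vertexHomotopy_eqOn_convexHull (hτ : τ ∈ T.faces) {α : E →ᵃ[ℝ] E}
    (hα : EqOn α (fun v => γ v t) τ) :
    EqOn (T.vertexHomotopy γ t) α (convexHull ℝ (τ : Set E)) := fun x hx => by
  obtain ⟨w, hw, hwτ⟩ := Geometry.SimplicialComplex.exists_isBarycentric hτ hx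
  obtain ⟨-, -, hw₁, hwx⟩ := id hw
  rw [Geometry.SimplicialComplex.vertexHomotopy, hw.barycentric_eq, ← hwx, Finsupp.sum,
    Finsupp.sum, affineMap_sum_smul α _ hw₁]
  exact Finset.sum_congr rfl fun v hv => by rw [hα (hwτ hv)]

theorem vertexHomotopy_vertex (hv : v ∈ T.vertices) : T.vertexHomotopy γ t v = γ v t :=
  vertexHomotopy_eqOn_convexHull hv (α := AffineMap.const ℝ E (γ v t)) (by simp [EqOn]) (by simp)

theorem image_vertexHomotopy_convexHull (hτ : τ ∈ T.faces) :
    T.vertexHomotopy γ t '' convexHull ℝ (τ : Set E) =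
      convexHull ℝ (T.vertexHomotopy γ t '' (τ : Set E)) := by
  obtain ⟨α, hα⟩ := exists_affineMap_eqOn (T.indep hτ) fun v => γ v t
  have heq := vertexHomotopy_eqOn_convexHull hτ hα
  rw [heq.image_eq, (heq.mono (subset_convexHull ℝ _)).image_eq, AffineMap.image_convexHull]

end VertexHomotopy

section Counting

open Geometry.SimplicialComplex

variable {E : Type*} [AddCommGroup E] [Module ℝ E]

theorem odd_imageSign_of_ne_zero {τ : Finset E} {f : E → E} (h : imageSign τ f ≠ 0) :
    Odd (imageSign τ f) := by
  revert h
  rw [imageSign]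
  split_ifs <;> decide

theorem odd_sum_iff_odd_card {ι : Type*} {s : Finset ι} {f : ι → ℤ} (hf : ∀ i ∈ s, Odd (f i)) :
    Odd (∑ i ∈ s, f i) ↔ Odd s.card := by
  have heven : Even (∑ i ∈ s, f i - s.card) := by
    rw [Finset.cast_card, ← Finset.sum_sub_distrib]
    exact Finset.even_sum _ fun i hi => (hf i hi).sub_odd odd_one
  rw [← Int.not_even_iff_odd, Int.even_sub.1 heven, Int.even_coe_nat, Nat.not_even_iff_odd]

theorem sum_imageSign (S : Finset (Finset E)) (f : E → E) :
    ∑ τ ∈ S, imageSign τ f =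
      ({τ ∈ (S : Set (Finset E)) | ImagePositive τ f}.ncard : ℤ) -
        {τ ∈ (S : Set (Finset E)) | ImageNegative τ f}.ncard := by
  classical
  simp only [imageSign, Finset.sum_sub_distrib, Finset.sum_boole, ← Finset.coe_filter,
    ncard_coe_finset, SetLike.mem_coe]

theorem odd_ncard_and_ncard_imagePositive_eq {S : Finset (Finset E)} {f : E → E}
    (hsum : ∑ τ ∈ S, imageSign τ f = 1) (hS : ∀ τ ∈ S, imageSign τ f ≠ 0) :
    Odd (S : Set (Finset E)).ncard ∧
      {τ ∈ (S : Set (Finset E)) | ImagePositive τ f}.ncard =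
        {τ ∈ (S : Set (Finset E)) | ImageNegative τ f}.ncard + 1 := by
  constructor
  · rw [ncard_coe_finset, ← odd_sum_iff_odd_card fun τ hτ => odd_imageSign_of_ne_zero (hS τ hτ),
      hsum]
    exact odd_one
  · rw [sum_imageSign] at hsum
    omega

end Counting


namespace Polytope.IsTriangulation

variable {d n : ℕ} {P : Polytope d n} {T : Geometry.SimplicialComplex ℝ (EuclideanSpace ℝ (Fin n))}
  {γ : EuclideanSpace ℝ (Fin n) → I → EuclideanSpace ℝ (Fin n)} {t : I}
  {y : EuclideanSpace ℝ (Fin n)} {f : EuclideanSpace ℝ (Fin n) → EuclideanSpace ℝ (Fin n)}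

open Classical in
theorem covering_vertexHomotopy (hT : P.IsTriangulation T) :
    T.covering d (T.vertexHomotopy γ t) y =
      ({τ ∈ hT.topSimplices | y ∈ convexHull ℝ (T.vertexHomotopy γ t '' (τ : Set _))} :
        Finset (Finset (EuclideanSpace ℝ (Fin n)))) := by
  ext τ
  rw [Finset.mem_coe, Finset.mem_filter, hT.mem_topSimplices, and_assoc]
  refine and_congr_right fun hτ => ?_
  rw [image_vertexHomotopy_convexHull hτ]

theorem imageSign_ne_zero_of_mem_convexHull (hT : P.IsTriangulation T)
    (hf : ∀ v ∈ T.vertices, f v ∈ affineSpan ℝ (P.minimalCell v))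
    (hy : InGeneralPosition d (f '' T.vertices) y) {τ : Finset (EuclideanSpace ℝ (Fin n))}
    (hτ : τ ∈ hT.topSimplices) (hyτ : y ∈ convexHull ℝ (f '' τ)) : imageSign τ f ≠ 0 := by
  obtain ⟨hτ, hcard⟩ := hT.mem_topSimplices.1 hτ
  refine imageSign_ne_zero_of_inGeneralPosition (T.indep hτ) hcard (fun v hv => ?_)
    (fun v hv => mem_image_of_mem f (mem_vertices_of_mem_face hτ hv)) hy
    (convexHull_subset_affineSpan _ hyτ)
  exact affineSpan_le.2 (hT.minimalCell_subset_affineSpan hτ hcard hv)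
    (hf v (mem_vertices_of_mem_face hτ hv))

end Polytope.IsTriangulation

theorem mainTheorem6_general {d n : ℕ} (P : Polytope d n)
    (T : Geometry.SimplicialComplex ℝ (EuclideanSpace ℝ (Fin n))) (hT : P.IsTriangulation T)
    (γ : EuclideanSpace ℝ (Fin n) → I → EuclideanSpace ℝ (Fin n)) (t : I)
    (hγ_mem : ∀ v ∈ T.vertices, γ v t ∈ affineSpan ℝ (P.minimalCell v)) :
    ∀ᵐ x ∂(μHE[d]).restrict P.space,
      Odd (T.covering d (T.vertexHomotopy γ t) x).ncard ∧
      {τ ∈ T.covering d (T.vertexHomotopy γ t) x |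
          Geometry.SimplicialComplex.ImagePositive τ (T.vertexHomotopy γ t)}.ncard =
        {τ ∈ T.covering d (T.vertexHomotopy γ t) x |
          Geometry.SimplicialComplex.ImageNegative τ (T.vertexHomotopy γ t)}.ncard + 1 := by
  classical
  have hf : ∀ v ∈ T.vertices, T.vertexHomotopy γ t v ∈ affineSpan ℝ (P.minimalCell v) := by
    intro v hv
    rw [vertexHomotopy_vertex hv]
    exact hγ_mem v hv
  rw [ae_restrict_iff' P.isClosed_space.measurableSet]
  filter_upwards [ae_inGeneralPosition (hT.finite_vertices.union (hT.finite_vertices.image _))]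
    with y hy hyP
  have hsum := hT.sum_coverSign_eq_one hf hy hyP
  simp only [coverSign] at hsum
  rw [← Finset.sum_filter] at hsum
  rw [hT.covering_vertexHomotopy]
  refine odd_ncard_and_ncard_imagePositive_eq hsum fun τ hτ => ?_
  obtain ⟨hτ, hyτ⟩ := Finset.mem_filter.1 hτ
  exact hT.imageSign_ne_zero_of_mem_convexHull hf
    (fun s hs => hy s (hs.trans subset_union_right)) hτ hyτ

theorem mainTheorem6 {d n : ℕ} (P : Polytope d n)
    (T : Geometry.SimplicialComplex ℝ (EuclideanSpace ℝ (Fin n))) (hT : P.IsTriangulation T)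
    (γ : EuclideanSpace ℝ (Fin n) → I → EuclideanSpace ℝ (Fin n))
    (hγ_cont : ∀ v ∈ T.vertices, Continuous (γ v))
    (hγ_mem : ∀ v ∈ T.vertices, ∀ t : I, γ v t ∈ affineSpan ℝ (P.minimalCell v))
    (hγ_zero : ∀ v ∈ T.vertices, γ v 0 = v) :
    ∀ᵐ x ∂(μHE[d]).restrict P.space,
      Odd (T.covering d (T.vertexHomotopy γ 1) x).ncard ∧
      {τ ∈ T.covering d (T.vertexHomotopy γ 1) x |
          Geometry.SimplicialComplex.ImagePositive τ (T.vertexHomotopy γ 1)}.ncard =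
        {τ ∈ T.covering d (T.vertexHomotopy γ 1) x |
          Geometry.SimplicialComplex.ImageNegative τ (T.vertexHomotopy γ 1)}.ncard + 1 :=
  mainTheorem6_general P T hT γ 1 fun v hv => hγ_mem v hv 1
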